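/- Conventions. Manifolds are real, smooth, without boundary, Hausdorff and second countable, except that disjoint unions of arbitrarily many charts are allowed as bases of Lie groupoids and that the manifold of arrows of a Lie groupoid may be non-Hausdorff. Let $Q$ be a topological space. An orbifold chart of dimension $n\in\mathbb N_0$ on $Q$ is a triple $(V,G,\pi)$, where $V$ is a connected $n$-manifold, $G$ is a finite subgroup of $\mathrm{Diff}(V)$ and $\pi\colon V\to Q$ is a map with open image that induces a homeomorphism $G\backslash V\to\pi(V)$. Two charts $(V,G,\pi)$, $(V',G',\pi')$ are compatible if for all $x\in V$, $y\in V'$ with $\pi(x)=\pi'(y)$ there is a diffeomorphism $h$ from an open neighborhood of $x$ onto an open neighborhood of $y$ with $h(x)=y$ and $\pi'\circ h=\pi$ on the domain of $h$. An orbifold atlas of dimension $n$ on $Q$ is a set of pairwise compatible $n$-dimensional charts whose images cover $Q$. An orbifold structure is a maximal orbifold atlas $\mathcal U$; an atlas contained in $\mathcal U$ is called a representative of $\mathcal U$. An orbifold is a pair $(Q,\mathcal U)$ with $Q$ second countable and Hausdorff and $\mathcal U$ an orbifold structure on $Q$. For an orbifold atlas $\mathcal V=\{(V_i,G_i,\pi_i)\mid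 i\in I\}$ on $Q$ put $V=\coprod_i V_i$ and $\pi=\coprod_i\pi_i\colon V\to Q$. The atlas groupoid $\Gamma(\mathcal V)$ is the étale Lie groupoid with base $V$ whose arrows are the germs $\mathrm{germ}_x f\colon x\to f(x)$ of diffeomorphisms $f$ between open subsets of $V$ with $\pi\circ f=\pi|_{\mathrm{dom} f}$, with the germ topology and germ differential structure. The map $\alpha_{\mathcal V}\colon|\Gamma(\mathcal V)|\to Q$, $[x]\mapsto\pi(x)$, is a homeomorphism from the orbit space onto $Q$. A marked atlas groupoid over $Q$ is a triple of the form $(\Gamma(\mathcal V),\alpha_{\mathcal V},Q)$, where $Q$ is second countable and Hausdorff and $\mathcal V$ is an orbifold atlas on $Q$ of some dimension. A homomorphism $\varphi=(\varphi_0,\varphi_1)\colon G\to H$ of Lie groupoids (a smooth functor, inducing $|\varphi|\colon|G|\to|H|$) is a weak equivalence if $t\circ\mathrm{pr}_1\colon H_1\times_{s,H_0,\varphi_0}G_0\to H_0$ is a surjective submersion and the square formed by $\varphi_1\colon G_1\to H_1$, $\varphi_0\times\varphi_0\colon G_0\times G_0\to H_0\times H_0$ and the maps $(s,t)$ is a fibered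 product of manifolds. A unit weak equivalence $(G_1,\alpha_1,Q)\to(G_2,\alpha_2,Q)$ of marked atlas groupoids is a weak equivalence $\varphi\colon G_1\to G_2$ with $\alpha_2\circ|\varphi|\circ\alpha_1^{-1}=\mathrm{id}_Q$. Two marked atlas groupoids $A,B$ over $Q$ are unit Morita equivalent if there are a marked atlas groupoid $K$ over $Q$ and unit weak equivalences $K\to A$ and $K\to B$. Proposition. Let $Q$ be a second countable Hausdorff space. (1) Unit Morita equivalence is an equivalence relation on the marked atlas groupoids over $Q$. (2) Let $Q$ be non-empty, let $\mathcal U$ be an orbifold structure on $Q$ and let $\mathcal V$ be a representative of $\mathcal U$. Then the unit Morita equivalence class of $(\Gamma(\mathcal V),\alpha_{\mathcal V},Q)$ is $$\Gamma(Q,\mathcal U)=\{(\Gamma(\mathcal W),\alpha_{\mathcal W},Q)\mid \mathcal W\text{ is a representative of }\mathcal U\}.$$ -/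

import Mathlib

open Set Filter Topology Manifold
open scoped ContDiff

universe u v w

noncomputable section

namespace ReducedOrbifold

/-! ### Manifold structures on disjoint unions and along local homeomorphisms -/

section Pullback

variable {n : ℕ} {M : Type u} {N : Type v} [TopologicalSpace M] [TopologicalSpace N]
  [ChartedSpace (EuclideanSpace ℝ (Fin n)) N] {p : M → N}

/-- The unique smooth structure on `M` for which the local homeomorphism `p : M → N` becomes a
local diffeomorphism: charts of `M` are charts of `N` composed with local restrictions of `p`. -/
@[reducible]
def pullbackCharts (hp : IsLocalHomeomorph p) :
    ChartedSpace (EuclideanSpace ℝ (Fin n)) M where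
  atlas := {e | ∃ (f : OpenPartialHomeomorph M N)
    (c : OpenPartialHomeomorph N (EuclideanSpace ℝ (Fin n))),
    EqOn p f f.source ∧ c ∈ atlas (EuclideanSpace ℝ (Fin n)) N ∧ e = f ≫ₕ c}
  chartAt x := (hp x).choose ≫ₕ chartAt (EuclideanSpace ℝ (Fin n)) (p x)
  mem_chart_source x := by
    have h := (hp x).choose_spec
    have h2 : p x = (hp x).choose x := congrFun h.2 x
    simp only [OpenPartialHomeomorph.trans_source, mem_inter_iff, mem_preimage]
    exact ⟨h.1, by rw [← h2]; exact mem_chart_source _ _⟩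
  chart_mem_atlas x := ⟨_, _, fun y _ => congrFun (hp x).choose_spec.2 y,
    chart_mem_atlas _ _, rfl⟩

theorem pullbackCharts_isManifold [IsManifold (𝓡 n) ∞ N] (hp : IsLocalHomeomorph p) :
    letI := pullbackCharts (n := n) hp
    IsManifold (𝓡 n) ∞ M := by
  let _ := pullbackCharts (n := n) hp
  refine isManifold_of_contDiffOn (𝓡 n) ∞ M ?_
  rintro _ _ ⟨f, c, hf, hc, rfl⟩ ⟨f', c', hf', hc', rfl⟩
  have hcc := (contDiffGroupoid ∞ (𝓡 n)).compatible hc hc'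
  rw [contDiffGroupoid, mem_groupoid_of_pregroupoid] at hcc
  have hcc1 := hcc.1
  simp only [contDiffPregroupoid, modelWithCornersSelf_coe, modelWithCornersSelf_coe_symm,
    Function.comp_id, Function.id_comp, range_id, inter_univ, preimage_id] at hcc1 ⊢
  have key : ∀ x ∈ ((f ≫ₕ c).symm ≫ₕ f' ≫ₕ c').source,
      f' (f.symm (c.symm x)) = c.symm x := by
    intro x hx
    simp only [OpenPartialHomeomorph.trans_source, OpenPartialHomeomorph.symm_source,
      OpenPartialHomeomorph.trans_target, mem_inter_iff, mem_preimage,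
      OpenPartialHomeomorph.coe_trans_symm, Function.comp_apply] at hx
    rw [← hf' hx.2.1, hf (f.map_target hx.1.2), f.right_inv hx.1.2]
  have hsub : ((f ≫ₕ c).symm ≫ₕ f' ≫ₕ c').source ⊆ (c.symm ≫ₕ c').source := by
    intro x hx
    have hk := key x hx
    simp only [OpenPartialHomeomorph.trans_source, OpenPartialHomeomorph.symm_source,
      OpenPartialHomeomorph.trans_target, mem_inter_iff, mem_preimage,
      OpenPartialHomeomorph.coe_trans_symm, Function.comp_apply] at hx ⊢
    rw [hk] at hx
    exact ⟨hx.1.1, hx.2.2⟩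
  refine (hcc1.mono hsub).congr ?_
  intro x hx
  have hk := key x hx
  simp only [OpenPartialHomeomorph.coe_trans, OpenPartialHomeomorph.coe_trans_symm,
    Function.comp_apply]
  rw [hk]

theorem pullbackCharts_mem_atlas (hp : IsLocalHomeomorph p) (f : OpenPartialHomeomorph M N)
    (hf : EqOn p f f.source) (y : N) :
    f ≫ₕ chartAt (EuclideanSpace ℝ (Fin n)) y ∈ (pullbackCharts (n := n) hp).atlas :=
  ⟨f, _, hf, chart_mem_atlas _ _, rfl⟩

theorem pullbackCharts_contMDiff [IsManifold (𝓡 n) ∞ N] (hp : IsLocalHomeomorph p) :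
    letI := pullbackCharts (n := n) hp
    ContMDiff (𝓡 n) (𝓡 n) ∞ p := by
  let _ := pullbackCharts (n := n) hp
  have := pullbackCharts_isManifold (n := n) hp
  intro x
  obtain ⟨f, hx, hf⟩ := hp x
  have hf' : EqOn p f f.source := fun y _ => congrFun hf y
  have he := IsManifold.subset_maximalAtlas (I := 𝓡 n) (n := ∞)
    (pullbackCharts_mem_atlas (n := n) hp f hf' (p x))
  set c := chartAt (EuclideanSpace ℝ (Fin n)) (p x) with hc
  have hxe : x ∈ (f ≫ₕ c).source := by
    simp only [OpenPartialHomeomorph.trans_source, mem_inter_iff, mem_preimage]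
    exact ⟨hx, by rw [← hf' hx]; exact mem_chart_source _ _⟩
  have h1 := (contMDiffOn_of_mem_maximalAtlas he).contMDiffAt
    ((f ≫ₕ c).open_source.mem_nhds hxe)
  have h2 := (contMDiffOn_symm_of_mem_maximalAtlas
    (IsManifold.chart_mem_maximalAtlas (I := 𝓡 n) (n := ∞) (p x))).contMDiffAt
    (c.open_target.mem_nhds (c.map_source (mem_chart_source _ (p x))))
  have h3 : (f ≫ₕ c) x = c (p x) := by
    simp only [OpenPartialHomeomorph.coe_trans, Function.comp_apply]; rw [← hf' hx]
  rw [← h3] at h2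
  refine (h2.comp x h1).congr_of_eventuallyEq ?_
  filter_upwards [(f ≫ₕ c).open_source.mem_nhds hxe] with z hz
  simp only [OpenPartialHomeomorph.trans_source, mem_inter_iff, mem_preimage] at hz
  simp only [Function.comp_apply, OpenPartialHomeomorph.coe_trans]
  rw [c.left_inv hz.2, hf' hz.1]

theorem pullbackCharts_contMDiffOn_symm [IsManifold (𝓡 n) ∞ N] (hp : IsLocalHomeomorph p)
    (f : OpenPartialHomeomorph M N) (hf : EqOn p f f.source) :
    letI := pullbackCharts (n := n) hp
    ContMDiffOn (𝓡 n) (𝓡 n) ∞ f.symm f.target := by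
  let _ := pullbackCharts (n := n) hp
  have := pullbackCharts_isManifold (n := n) hp
  intro y hy
  refine ContMDiffAt.contMDiffWithinAt ?_
  have he := IsManifold.subset_maximalAtlas (I := 𝓡 n) (n := ∞)
    (pullbackCharts_mem_atlas (n := n) hp f hf y)
  set c := chartAt (EuclideanSpace ℝ (Fin n)) y with hc
  have hye : c y ∈ (f ≫ₕ c).target := by
    simp only [OpenPartialHomeomorph.trans_target, mem_inter_iff, mem_preimage]
    exact ⟨c.map_source (mem_chart_source _ y), by rwa [c.left_inv (mem_chart_source _ y)]⟩
  have h1 := (contMDiffOn_symm_of_mem_maximalAtlas he).contMDiffAt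
    ((f ≫ₕ c).open_target.mem_nhds hye)
  have h2 := (contMDiffOn_of_mem_maximalAtlas
    (IsManifold.chart_mem_maximalAtlas (I := 𝓡 n) (n := ∞) y)).contMDiffAt
    (c.open_source.mem_nhds (mem_chart_source _ y))
  refine (h1.comp y h2).congr_of_eventuallyEq ?_
  filter_upwards [c.open_source.mem_nhds (mem_chart_source _ y)] with z hz
  simp only [Function.comp_apply, OpenPartialHomeomorph.coe_trans_symm]
  rw [c.left_inv hz]

end Pullback

section Coproduct

variable {n : ℕ} {ι : Type u} {V : ι → Type v} [∀ i, TopologicalSpace (V i)]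
  [∀ i, ChartedSpace (EuclideanSpace ℝ (Fin n)) (V i)]

/-- The smooth structure on a disjoint union of `n`-manifolds (of arbitrary cardinality). -/
@[reducible]
def sigmaCharts : ChartedSpace (EuclideanSpace ℝ (Fin n)) (Σ i, V i) where
  atlas := {e | ∃ (i : ι) (c : OpenPartialHomeomorph (V i) (EuclideanSpace ℝ (Fin n))),
    c ∈ atlas (EuclideanSpace ℝ (Fin n)) (V i) ∧
      e = c.lift_openEmbedding (X' := Σ i, V i) IsOpenEmbedding.sigmaMk}
  chartAt x := (chartAt (EuclideanSpace ℝ (Fin n)) x.2).lift_openEmbedding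
    (X' := Σ i, V i) IsOpenEmbedding.sigmaMk
  mem_chart_source x := by
    rw [OpenPartialHomeomorph.lift_openEmbedding_source]
    exact ⟨x.2, mem_chart_source _ _, rfl⟩
  chart_mem_atlas x := ⟨_, _, chart_mem_atlas _ _, rfl⟩

theorem sigmaCharts_isManifold [∀ i, IsManifold (𝓡 n) ∞ (V i)] :
    letI := sigmaCharts (n := n) (V := V)
    IsManifold (𝓡 n) ∞ (Σ i, V i) := by
  let _ := sigmaCharts (n := n) (V := V)
  refine { compatible := ?_ }
  rintro _ _ ⟨i, c, hc, rfl⟩ ⟨j, d, hd, rfl⟩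
  by_cases hij : i = j
  · subst hij
    rw [OpenPartialHomeomorph.lift_openEmbedding_trans]
    exact (contDiffGroupoid ∞ (𝓡 n)).compatible hc hd
  · apply ContDiffGroupoid.mem_of_source_eq_empty
    ext x
    simp only [OpenPartialHomeomorph.trans_source, OpenPartialHomeomorph.symm_source,
      OpenPartialHomeomorph.lift_openEmbedding_source, mem_inter_iff, mem_preimage,
      OpenPartialHomeomorph.lift_openEmbedding_symm, Function.comp_apply, mem_empty_iff_false,
      iff_false, not_and]
    rintro - ⟨y, -, hy⟩
    exact hij (congrArg Sigma.fst hy).symm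

/-- The inclusion of a component into a disjoint union of manifolds is a diffeomorphism onto an
open subset. -/
def sigmaInclusion [∀ i, IsManifold (𝓡 n) ∞ (V i)] (i : ι) [Nonempty (V i)] :
    letI := sigmaCharts (n := n) (V := V)
    PartialDiffeomorph (𝓡 n) (𝓡 n) (V i) (Σ i, V i) ∞ :=
  letI := sigmaCharts (n := n) (V := V)
  let e := (IsOpenEmbedding.sigmaMk (σ := V) (i := i)).toOpenPartialHomeomorph
  { toPartialEquiv := e.toPartialEquiv
    open_source := e.open_source
    open_target := e.open_target
    contMDiffOn_toFun := by
      have := sigmaCharts_isManifold (n := n) (V := V)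
      intro x _
      refine ContMDiffAt.contMDiffWithinAt ?_
      set c := chartAt (EuclideanSpace ℝ (Fin n)) x with hc
      have h1 := (contMDiffOn_of_mem_maximalAtlas
        (IsManifold.chart_mem_maximalAtlas (I := 𝓡 n) (n := ∞) x)).contMDiffAt
        (c.open_source.mem_nhds (mem_chart_source _ x))
      have h2 := (contMDiffOn_symm_of_mem_maximalAtlas
        (IsManifold.chart_mem_maximalAtlas (I := 𝓡 n) (n := ∞)
          (⟨i, x⟩ : Σ i, V i))).contMDiffAt
        (x := c x) (c.open_target.mem_nhds (c.map_source (mem_chart_source _ x)))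
      refine (h2.comp x h1).congr_of_eventuallyEq ?_
      filter_upwards [c.open_source.mem_nhds (mem_chart_source _ x)] with z hz
      exact congrArg (Sigma.mk i) (c.left_inv hz).symm
    contMDiffOn_invFun := by
      have := sigmaCharts_isManifold (n := n) (V := V)
      rintro _ ⟨x, -, rfl⟩
      refine ContMDiffAt.contMDiffWithinAt ?_
      change ContMDiffAt _ _ _ e.symm (⟨i, x⟩ : Σ i, V i)
      set c := chartAt (EuclideanSpace ℝ (Fin n)) x with hc
      set d := chartAt (EuclideanSpace ℝ (Fin n)) (⟨i, x⟩ : Σ i, V i) with hd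
      have hdc : ∀ z, d ⟨i, z⟩ = c z := fun z =>
        OpenPartialHomeomorph.lift_openEmbedding_apply _ IsOpenEmbedding.sigmaMk
      have h1 := (contMDiffOn_of_mem_maximalAtlas
        (IsManifold.chart_mem_maximalAtlas (I := 𝓡 n) (n := ∞)
          (⟨i, x⟩ : Σ i, V i))).contMDiffAt (d.open_source.mem_nhds (mem_chart_source _ _))
      have h2 := (contMDiffOn_symm_of_mem_maximalAtlas
        (IsManifold.chart_mem_maximalAtlas (I := 𝓡 n) (n := ∞) x)).contMDiffAt
        (x := d ⟨i, x⟩) (by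
          rw [hdc]
          exact c.open_target.mem_nhds (c.map_source (mem_chart_source _ x)))
      refine (h2.comp _ h1).congr_of_eventuallyEq ?_
      filter_upwards [d.open_source.mem_nhds (mem_chart_source _ _)] with z hz
      obtain ⟨z, hz, rfl⟩ := hz
      have h3 : e.symm (⟨i, z⟩ : Σ i, V i) = z := e.left_inv (mem_univ z)
      rw [h3]
      change z = c.symm (d ⟨i, z⟩)
      rw [hdc, c.left_inv hz] }

end Coproduct

/-! ### Lie groupoids -/

/-- A Lie groupoid: the arrow `g` goes from `src g` to `tgt g`, and `comp g f` is the composite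
`g ∘ f`. The object manifold is Hausdorff, the arrow manifold need not be; neither is required to
be second countable, since a disjoint union of uncountably many charts is allowed as base. -/
structure LieGroupoid where
  /-- dimension of the manifold of objects -/
  dimObj : ℕ
  /-- dimension of the manifold of arrows -/
  dimArr : ℕ
  /-- objects -/
  Obj : Type w
  /-- arrows -/
  Arr : Type w
  [topObj : TopologicalSpace Obj]
  [t2Obj : T2Space Obj]
  [chartedObj : ChartedSpace (EuclideanSpace ℝ (Fin dimObj)) Obj]
  [manifoldObj : IsManifold (𝓡 dimObj) ∞ Obj]
  [topArr : TopologicalSpace Arr]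
  [chartedArr : ChartedSpace (EuclideanSpace ℝ (Fin dimArr)) Arr]
  [manifoldArr : IsManifold (𝓡 dimArr) ∞ Arr]
  src : Arr → Obj
  tgt : Arr → Obj
  comp : ∀ g f : Arr, src g = tgt f → Arr
  unit : Obj → Arr
  inv : Arr → Arr
  src_comp : ∀ g f h, src (comp g f h) = src f
  tgt_comp : ∀ g f h, tgt (comp g f h) = tgt g
  comp_assoc : ∀ k g f (hkg : src k = tgt g) (hgf : src g = tgt f),
    comp k (comp g f hgf) (hkg.trans (tgt_comp g f hgf).symm) =
      comp (comp k g hkg) f ((src_comp k g hkg).trans hgf)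
  src_unit : ∀ x, src (unit x) = x
  tgt_unit : ∀ x, tgt (unit x) = x
  unit_comp : ∀ f, comp (unit (tgt f)) f (src_unit _) = f
  comp_unit : ∀ g, comp g (unit (src g)) (tgt_unit _).symm = g
  src_inv : ∀ g, src (inv g) = tgt g
  tgt_inv : ∀ g, tgt (inv g) = src g
  comp_inv : ∀ g, comp g (inv g) (tgt_inv g).symm = unit (tgt g)
  inv_comp : ∀ g, comp (inv g) g (src_inv g) = unit (src g)
  contMDiff_src : ContMDiff (𝓡 dimArr) (𝓡 dimObj) ∞ src
  contMDiff_tgt : ContMDiff (𝓡 dimArr) (𝓡 dimObj) ∞ tgt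
  /-- the source map is a submersion -/
  submersion_src : ∀ g, Function.Surjective (mfderiv (𝓡 dimArr) (𝓡 dimObj) src g)
  /-- the target map is a submersion -/
  submersion_tgt : ∀ g, Function.Surjective (mfderiv (𝓡 dimArr) (𝓡 dimObj) tgt g)
  /-- the composition is smooth on the submanifold of composable pairs, i.e. it extends locally to
  a smooth map on an open set of pairs of arrows -/
  contMDiff_comp : ∀ g f, src g = tgt f → ∃ (O : Set (Arr × Arr)) (F : Arr × Arr → Arr),
    IsOpen O ∧ (g, f) ∈ O ∧
    ContMDiffOn ((𝓡 dimArr).prod (𝓡 dimArr)) (𝓡 dimArr) ∞ F O ∧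
    ∀ g' f' (h : src g' = tgt f'), (g', f') ∈ O → F (g', f') = comp g' f' h
  contMDiff_unit : ContMDiff (𝓡 dimObj) (𝓡 dimArr) ∞ unit
  contMDiff_inv : ContMDiff (𝓡 dimArr) (𝓡 dimArr) ∞ inv

namespace LieGroupoid

attribute [instance] topObj t2Obj chartedObj manifoldObj topArr chartedArr manifoldArr

/-- Two objects are equivalent if there is an arrow from one to the other. -/
def orbitSetoid (G : LieGroupoid.{w}) : Setoid G.Obj where
  r x y := ∃ g : G.Arr, G.src g = x ∧ G.tgt g = y
  iseqv :=
    { refl := fun x => ⟨G.unit x, G.src_unit x, G.tgt_unit x⟩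
      symm := by
        rintro x y ⟨g, rfl, rfl⟩
        exact ⟨G.inv g, G.src_inv g, G.tgt_inv g⟩
      trans := by
        rintro x y z ⟨g, rfl, rfl⟩ ⟨k, hk, rfl⟩
        exact ⟨G.comp k g hk, G.src_comp k g hk, G.tgt_comp k g hk⟩ }

/-- The orbit space `|G|` with the quotient topology. -/
abbrev OrbitSpace (G : LieGroupoid.{w}) : Type w := Quotient G.orbitSetoid

/-- Homomorphisms of Lie groupoids: smooth functors. -/
structure Hom (G : LieGroupoid.{v}) (H : LieGroupoid.{w}) where
  obj : G.Obj → H.Obj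
  arr : G.Arr → H.Arr
  contMDiff_obj : ContMDiff (𝓡 G.dimObj) (𝓡 H.dimObj) ∞ obj
  contMDiff_arr : ContMDiff (𝓡 G.dimArr) (𝓡 H.dimArr) ∞ arr
  src_arr : ∀ g, H.src (arr g) = obj (G.src g)
  tgt_arr : ∀ g, H.tgt (arr g) = obj (G.tgt g)
  arr_comp : ∀ g f (h : G.src g = G.tgt f), arr (G.comp g f h) =
    H.comp (arr g) (arr f) ((src_arr g).trans ((congrArg obj h).trans (tgt_arr f).symm))
  arr_unit : ∀ x, arr (G.unit x) = H.unit (obj x)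
  arr_inv : ∀ g, arr (G.inv g) = H.inv (arr g)

/-- The map `|φ| : |G| → |H|` induced by a homomorphism `φ : G → H`. -/
def Hom.orbitMap {G : LieGroupoid.{v}} {H : LieGroupoid.{w}} (φ : Hom G H) :
    G.OrbitSpace → H.OrbitSpace :=
  Quotient.map φ.obj (by
    rintro x y ⟨g, rfl, rfl⟩
    exact ⟨φ.arr g, φ.src_arr g, φ.tgt_arr g⟩)

/-- Weak equivalences of Lie groupoids.

The first two conditions say that `(h, x) ↦ tgt h` is a surjective submersion on the manifold
`H₁ ×_{H₀} G₀ = {(h, x) | src h = φ₀ x}`; as `src` is a submersion, the tangent space of this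
manifold at `(h, x)` is `{(v, w) | d(src) v = d(φ₀) w}`.

The remaining conditions say that the square with horizontal maps `φ₁`, `φ₀ × φ₀` and vertical
maps `(src, tgt)` is a fibered product of manifolds, i.e. `(src, tgt, φ₁)` is a diffeomorphism of
`G₁` onto the submanifold `(G₀ × G₀) ×_{H₀ × H₀} H₁` of `G₀ × G₀ × H₁`: it is a smooth embedding
(an immersion that is a homeomorphism onto its image) with this image. -/
structure Hom.IsWeakEquivalence {G : LieGroupoid.{v}} {H : LieGroupoid.{w}} (φ : Hom G H) :
    Prop where
  surjective : ∀ y : H.Obj, ∃ (h : H.Arr) (x : G.Obj), H.src h = φ.obj x ∧ H.tgt h = y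
  submersion : ∀ (h : H.Arr) (x : G.Obj), H.src h = φ.obj x →
    ∀ a : TangentSpace (𝓡 H.dimObj) (H.tgt h),
      ∃ (b : TangentSpace (𝓡 H.dimArr) h) (c : TangentSpace (𝓡 G.dimObj) x),
        mfderiv (𝓡 H.dimArr) (𝓡 H.dimObj) H.src h b =
          mfderiv (𝓡 G.dimObj) (𝓡 H.dimObj) φ.obj x c ∧
        mfderiv (𝓡 H.dimArr) (𝓡 H.dimObj) H.tgt h b = a
  range_eq : range (fun g : G.Arr => (G.src g, G.tgt g, φ.arr g)) =
    {p : G.Obj × G.Obj × H.Arr | φ.obj p.1 = H.src p.2.2 ∧ φ.obj p.2.1 = H.tgt p.2.2}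
  isEmbedding : IsEmbedding (fun g : G.Arr => (G.src g, G.tgt g, φ.arr g))
  immersion : ∀ g : G.Arr, Function.Injective
    (mfderiv (𝓡 G.dimArr) ((𝓡 G.dimObj).prod ((𝓡 G.dimObj).prod (𝓡 H.dimArr)))
      (fun g : G.Arr => (G.src g, G.tgt g, φ.arr g)) g)

end LieGroupoid

/-- A Lie groupoid `G` marked by the topological space `X`: a homeomorphism `α : |G| → X`. -/
structure MarkedLieGroupoid (X : Type u) [TopologicalSpace X] where
  toLieGroupoid : LieGroupoid.{w}
  marking : toLieGroupoid.OrbitSpace ≃ₜ X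

/-! ### The groupoid of germs of transitions over a map -/

/-- Transitions on `M`: diffeomorphisms between open subsets of `M`. -/
abbrev Transition (n : ℕ) (M : Type w) [TopologicalSpace M]
    [ChartedSpace (EuclideanSpace ℝ (Fin n)) M] : Type w :=
  PartialDiffeomorph (𝓡 n) (𝓡 n) M M ∞

section Germs

variable {n : ℕ} {M : Type w} [TopologicalSpace M] [ChartedSpace (EuclideanSpace ℝ (Fin n)) M]
  {Q : Type u}

/-- The pseudogroup of all transitions `f` on `M` with `p ∘ f = p` on the domain of `f`. -/
def liftPseudogroup (n : ℕ) {M : Type w} [TopologicalSpace M]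
    [ChartedSpace (EuclideanSpace ℝ (Fin n)) M] (p : M → Q) : Set (Transition n M) :=
  {f | ∀ x ∈ f.source, p (f x) = p x}

namespace Transition

/-- The identity transition on `M`. -/
def refl (n : ℕ) (M : Type w) [TopologicalSpace M]
    [ChartedSpace (EuclideanSpace ℝ (Fin n)) M] : Transition n M where
  toPartialEquiv := PartialEquiv.refl M
  open_source := isOpen_univ
  open_target := isOpen_univ
  contMDiffOn_toFun := contMDiffOn_id
  contMDiffOn_invFun := contMDiffOn_id

/-- The restriction of a transition to an open set. -/
def restr (f : Transition n M) (O : Set M) (hO : IsOpen O) : Transition n M where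
  toPartialEquiv := (f.toOpenPartialHomeomorph.restrOpen O hO).toPartialEquiv
  open_source := (f.toOpenPartialHomeomorph.restrOpen O hO).open_source
  open_target := (f.toOpenPartialHomeomorph.restrOpen O hO).open_target
  contMDiffOn_toFun := f.contMDiffOn_toFun.mono (fun _ hx => hx.1)
  contMDiffOn_invFun := f.contMDiffOn_invFun.mono (fun _ hx => hx.1)

theorem continuousAt (f : Transition n M) {x : M} (hx : x ∈ f.source) : ContinuousAt f x :=
  (f.contMDiffOn_toFun.continuousOn).continuousAt (f.open_source.mem_nhds hx)

end Transition

/-- Arrows of the groupoid of germs: the germs `germ_x f` of elements `f` of the pseudogroup over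
`p` at points `x` of their domains. -/
@[ext]
structure GermArrow (n : ℕ) {M : Type w} [TopologicalSpace M]
    [ChartedSpace (EuclideanSpace ℝ (Fin n)) M] (p : M → Q) where
  src : M
  germ : Germ (𝓝 src) M
  exists_rep : ∃ f ∈ liftPseudogroup n p, src ∈ f.source ∧ germ = ((f : M → M) : Germ (𝓝 src) M)

namespace GermArrow

variable {p : M → Q}

/-- The arrow `germ_x f`. -/
def of (f : Transition n M) (hf : f ∈ liftPseudogroup n p) (x : M) (hx : x ∈ f.source) :
    GermArrow n p :=
  ⟨x, (f : M → M), f, hf, hx, rfl⟩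

/-- `t(germ_x f) = f x` -/
def tgt (g : GermArrow n p) : M := g.germ.value

theorem tgt_of (f : Transition n M) (hf : f ∈ liftPseudogroup n p) (x : M) (hx : x ∈ f.source) :
    (of f hf x hx).tgt = f x := rfl

theorem exists_eq_of (g : GermArrow n p) :
    ∃ (f : Transition n M) (hf : f ∈ liftPseudogroup n p) (x : M) (hx : x ∈ f.source),
      g = of f hf x hx := by
  obtain ⟨x, γ, f, hf, hx, rfl⟩ := g
  exact ⟨f, hf, x, hx, rfl⟩

theorem of_eq_of {f f' : Transition n M} {hf : f ∈ liftPseudogroup n p}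
    {hf' : f' ∈ liftPseudogroup n p} {x x' : M} {hx : x ∈ f.source} {hx' : x' ∈ f'.source}
    (h : x = x') (hff : (f : M → M) =ᶠ[𝓝 x] f') : of f hf x hx = of f' hf' x' hx' := by
  subst h
  have : ((f : M → M) : Germ (𝓝 x) M) = ((f' : M → M) : Germ (𝓝 x) M) := Germ.coe_eq.2 hff
  simp only [of, this]

theorem proj_tgt (g : GermArrow n p) : p g.tgt = p g.src := by
  obtain ⟨f, hf, x, hx, rfl⟩ := g.exists_eq_of
  exact hf x hx

theorem refl_mem : Transition.refl n M ∈ liftPseudogroup n p := fun _ _ => rfl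

theorem symm_mem {f : Transition n M} (hf : f ∈ liftPseudogroup n p) :
    (f.symm : Transition n M) ∈ liftPseudogroup n p := by
  intro y hy
  have h := hf _ (f.map_target hy)
  exact h.symm.trans (congrArg p (f.right_inv hy))

theorem trans_mem {f g : Transition n M} (hf : f ∈ liftPseudogroup n p)
    (hg : g ∈ liftPseudogroup n p) : (f.trans g : Transition n M) ∈ liftPseudogroup n p :=
  fun x hx => (hg _ hx.2).trans (hf x hx.1)

theorem restr_mem {f : Transition n M} (hf : f ∈ liftPseudogroup n p) (O : Set M)
    (hO : IsOpen O) : f.restr O hO ∈ liftPseudogroup n p :=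
  fun x hx => hf x hx.1

/-- `u(x) = germ_x id` -/
def unit (n : ℕ) {M : Type w} [TopologicalSpace M]
    [ChartedSpace (EuclideanSpace ℝ (Fin n)) M] (p : M → Q) (x : M) : GermArrow n p :=
  of (Transition.refl n M) refl_mem x (mem_univ x)

theorem tendsto_germ (f : GermArrow n p) {y : M} (h : y = f.tgt) : f.germ.Tendsto (𝓝 y) := by
  obtain ⟨f, hf, x, hx, rfl⟩ := f.exists_eq_of
  subst h
  exact Transition.continuousAt f hx

/-- Composition of arrows: the composition of germs. -/
def comp (g f : GermArrow n p) (h : g.src = f.tgt) : GermArrow n p where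
  src := f.src
  germ := g.germ.compTendsto' f.germ (f.tendsto_germ h)
  exists_rep := by
    obtain ⟨f, hf, x, hx, rfl⟩ := f.exists_eq_of
    obtain ⟨g, hg, y, hy, rfl⟩ := g.exists_eq_of
    change y = f x at h
    subst h
    exact ⟨f.trans g, trans_mem hf hg, ⟨hx, hy⟩, rfl⟩

/-- `germ_{f x} g ∘ germ_x f = germ_x (g ∘ f)` -/
theorem comp_of {f g : Transition n M} (hf : f ∈ liftPseudogroup n p)
    (hg : g ∈ liftPseudogroup n p) (x : M) (hx : x ∈ f.source) (hy : f x ∈ g.source) :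
    comp (of g hg (f x) hy) (of f hf x hx) rfl = of (f.trans g) (trans_mem hf hg) x ⟨hx, hy⟩ :=
  rfl

/-- Inversion of arrows, computed on a representative. -/
def inv (g : GermArrow n p) : GermArrow n p :=
  of g.exists_rep.choose.symm (symm_mem g.exists_rep.choose_spec.1) g.tgt (by
    have h := g.exists_rep.choose_spec
    have h2 : g.tgt = g.exists_rep.choose g.src := by
      rw [tgt]; conv_lhs => rw [h.2.2]
      rfl
    rw [h2]
    exact g.exists_rep.choose.map_source h.2.1)

theorem eventually_eq_symm {f f' : Transition n M} {x : M} (hx : x ∈ f.source)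
    (hx' : x ∈ f'.source) (h : (f : M → M) =ᶠ[𝓝 x] f') :
    (f.symm : M → M) =ᶠ[𝓝 (f x)] f'.symm := by
  have hxy : f x = f' x := h.self_of_nhds
  have hc : ContinuousAt f.symm (f x) := Transition.continuousAt f.symm (f.map_source hx)
  have hb : f.symm (f x) = x := f.left_inv hx
  have h1 : ∀ᶠ z in 𝓝 (f x), f (f.symm z) = f' (f.symm z) ∧ f.symm z ∈ f'.source := by
    have := (h.and (f'.open_source.mem_nhds hx'))
    rw [← hb] at this
    exact hc.eventually this
  filter_upwards [h1, f.open_target.mem_nhds (f.map_source hx)] with z hz hzt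
  have h3 : f (f.symm z) = z := f.right_inv hzt
  have h4 : f'.symm (f' (f.symm z)) = f.symm z := f'.left_inv hz.2
  rw [← h4, ← hz.1, h3]

/-- `(germ_x f)⁻¹ = germ_{f x} f⁻¹` -/
theorem inv_of (f : Transition n M) (hf : f ∈ liftPseudogroup n p) (x : M) (hx : x ∈ f.source) :
    (of f hf x hx).inv = of f.symm (symm_mem hf) (f x) (f.map_source hx) := by
  have h := (of f hf x hx).exists_rep.choose_spec
  refine of_eq_of rfl ?_
  exact (eventually_eq_symm hx h.2.1 (Germ.coe_eq.1 h.2.2)).symm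

/-- `U_f = {germ_x f | x ∈ dom f}` -/
def sheet (f : Transition n M) : Set (GermArrow n p) :=
  {g | g.src ∈ f.source ∧ g.germ = ((f : M → M) : Germ (𝓝 g.src) M)}

theorem of_mem_sheet (f : Transition n M) (hf : f ∈ liftPseudogroup n p) (x : M)
    (hx : x ∈ f.source) : of f hf x hx ∈ sheet f := ⟨hx, rfl⟩

theorem eq_of_of_mem_sheet {f : Transition n M} (hf : f ∈ liftPseudogroup n p)
    {g : GermArrow n p} (hg : g ∈ sheet f) : g = of f hf g.src hg.1 := by
  obtain ⟨x, γ, h⟩ := g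
  have h2 : γ = ((f : M → M) : Germ (𝓝 x) M) := hg.2
  subst h2
  rfl

/-- The germ topology, generated by the sets `U_f` with `f` in the pseudogroup. -/
instance : TopologicalSpace (GermArrow n p) :=
  TopologicalSpace.generateFrom {U | ∃ f ∈ liftPseudogroup n p, U = sheet f}

theorem isOpen_sheet {f : Transition n M} (hf : f ∈ liftPseudogroup n p) :
    IsOpen (sheet f : Set (GermArrow n p)) :=
  TopologicalSpace.isOpen_generateFrom_of_mem ⟨f, hf, rfl⟩

theorem continuous_src : Continuous (src : GermArrow n p → M) := by
  refine continuous_def.2 fun O hO => isOpen_iff_forall_mem_open.2 fun g hg => ?_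
  obtain ⟨f, hf, x, hx, rfl⟩ := g.exists_eq_of
  refine ⟨sheet (f.restr O hO), ?_, isOpen_sheet (restr_mem hf O hO), ⟨⟨hx, hg⟩, rfl⟩⟩
  rintro k ⟨hk, -⟩
  exact hk.2

open Classical in
/-- The bijection `φ_f : U_f → dom f`, `germ_x f ↦ x`. -/
def sheetChart (f : Transition n M) (hf : f ∈ liftPseudogroup n p) :
    OpenPartialHomeomorph (GermArrow n p) M where
  toFun := src
  invFun x := if hx : x ∈ f.source then of f hf x hx else unit n p x
  source := sheet f
  target := f.source
  map_source' g hg := hg.1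
  map_target' x hx := by
    rw [dif_pos hx]
    exact of_mem_sheet f hf x hx
  left_inv' g hg := by
    rw [dif_pos hg.1]
    exact (eq_of_of_mem_sheet hf hg).symm
  right_inv' x hx := by
    rw [dif_pos hx]
    rfl
  open_source := isOpen_sheet hf
  open_target := f.open_source
  continuousOn_toFun := continuous_src.continuousOn
  continuousOn_invFun := by
    rw [continuousOn_iff_continuous_domRestrict]
    refine continuous_generateFrom_iff.2 ?_
    rintro _ ⟨k, hk, rfl⟩
    have : (f.source.domRestrict fun x => if hx : x ∈ f.source then of f hf x hx else unit n p x) ⁻¹'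
        (sheet k) = Subtype.val ⁻¹' (k.source ∩ {x | (f : M → M) =ᶠ[𝓝 x] k}) := by
      ext ⟨x, hx⟩
      simp only [mem_preimage, domRestrict_apply, dif_pos hx, sheet, mem_ofPred_eq, mem_inter_iff]
      exact and_congr Iff.rfl Germ.coe_eq
    rw [this]
    refine (k.open_source.inter ?_).preimage continuous_subtype_val
    exact isOpen_setOfPred_eventually_nhds

theorem sheetChart_symm_apply (f : Transition n M) (hf : f ∈ liftPseudogroup n p) {x : M}
    (hx : x ∈ f.source) : (sheetChart f hf).symm x = of f hf x hx := dif_pos hx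

theorem isLocalHomeomorph_src : IsLocalHomeomorph (src : GermArrow n p → M) := by
  intro g
  obtain ⟨f, hf, x, hx, rfl⟩ := g.exists_eq_of
  exact ⟨sheetChart f hf, of_mem_sheet f hf x hx, rfl⟩

theorem tgt_eq_on_sheet {f : Transition n M} (hf : f ∈ liftPseudogroup n p) {g : GermArrow n p}
    (hg : g ∈ sheet f) : g.tgt = f g.src := by
  conv_lhs => rw [eq_of_of_mem_sheet hf hg]
  rfl

theorem inv_inv (g : GermArrow n p) : g.inv.inv = g := by
  obtain ⟨f, hf, x, hx, rfl⟩ := g.exists_eq_of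
  rw [inv_of]
  refine (inv_of _ (symm_mem hf) (f x) (f.map_source hx)).trans ?_
  exact of_eq_of (f.left_inv hx) EventuallyEq.rfl

theorem src_inv (g : GermArrow n p) : g.inv.src = g.tgt := rfl

theorem tgt_inv (g : GermArrow n p) : g.inv.tgt = g.src := by
  rw [← src_inv, inv_inv]

theorem inv_mem_sheet {f : Transition n M} (hf : f ∈ liftPseudogroup n p) {g : GermArrow n p}
    (hg : g ∈ sheet f) : g.inv = (sheetChart f.symm (symm_mem hf)).symm g.tgt := by
  have ht : g.tgt ∈ (f.symm : Transition n M).source := by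
    rw [tgt_eq_on_sheet hf hg]
    exact f.map_source hg.1
  rw [sheetChart_symm_apply _ _ ht]
  conv_lhs => rw [eq_of_of_mem_sheet hf hg]
  rw [inv_of]
  exact of_eq_of (tgt_eq_on_sheet hf hg).symm EventuallyEq.rfl

/-- The germ differential structure: every `φ_f : U_f → dom f` is a diffeomorphism. -/
instance : ChartedSpace (EuclideanSpace ℝ (Fin n)) (GermArrow n p) :=
  pullbackCharts isLocalHomeomorph_src

variable [IsManifold (𝓡 n) ∞ M]

instance : IsManifold (𝓡 n) ∞ (GermArrow n p) :=
  pullbackCharts_isManifold isLocalHomeomorph_src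

theorem contMDiff_src : ContMDiff (𝓡 n) (𝓡 n) ∞ (src : GermArrow n p → M) :=
  pullbackCharts_contMDiff isLocalHomeomorph_src

theorem contMDiffOn_sheetChart_symm (f : Transition n M) (hf : f ∈ liftPseudogroup n p) :
    ContMDiffOn (𝓡 n) (𝓡 n) ∞ (sheetChart f hf).symm f.source :=
  pullbackCharts_contMDiffOn_symm isLocalHomeomorph_src (sheetChart f hf) fun _ _ => rfl

theorem contMDiff_tgt : ContMDiff (𝓡 n) (𝓡 n) ∞ (tgt : GermArrow n p → M) := by
  intro g
  obtain ⟨f, hf, x, hx, rfl⟩ := g.exists_eq_of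
  have h1 : ContMDiffAt (𝓡 n) (𝓡 n) ∞ f (of f hf x hx).src :=
    f.contMDiffOn_toFun.contMDiffAt (f.open_source.mem_nhds hx)
  refine (h1.comp _ (contMDiff_src _)).congr_of_eventuallyEq ?_
  filter_upwards [(isOpen_sheet hf).mem_nhds (of_mem_sheet f hf x hx)] with k hk
  exact tgt_eq_on_sheet hf hk

theorem contMDiff_unit : ContMDiff (𝓡 n) (𝓡 n) ∞ (unit n p) := by
  have h := contMDiffOn_sheetChart_symm (Transition.refl n M) (refl_mem (p := p))
  rw [← contMDiffOn_univ]
  exact h.congr fun x _ => (sheetChart_symm_apply _ _ (mem_univ x)).symm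

theorem contMDiff_inv : ContMDiff (𝓡 n) (𝓡 n) ∞ (inv : GermArrow n p → GermArrow n p) := by
  intro g
  obtain ⟨f, hf, x, hx, rfl⟩ := g.exists_eq_of
  have h1 : ContMDiffAt (𝓡 n) (𝓡 n) ∞ (sheetChart f.symm (symm_mem hf)).symm
      (of f hf x hx).tgt :=
    (contMDiffOn_sheetChart_symm _ (symm_mem hf)).contMDiffAt
      (f.open_target.mem_nhds (f.map_source hx))
  refine (h1.comp _ (contMDiff_tgt _)).congr_of_eventuallyEq ?_
  filter_upwards [(isOpen_sheet hf).mem_nhds (of_mem_sheet f hf x hx)] with k hk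
  exact inv_mem_sheet hf hk

theorem surjective_mfderiv_of_leftInverse {N N' : Type*} [TopologicalSpace N]
    [ChartedSpace (EuclideanSpace ℝ (Fin n)) N] [TopologicalSpace N']
    [ChartedSpace (EuclideanSpace ℝ (Fin n)) N'] {a : N → N'} {b : N' → N} {x : N} {y : N'}
    (hb : ContMDiffAt (𝓡 n) (𝓡 n) ∞ b y) (hba : b y = x)
    (ha : ContMDiffAt (𝓡 n) (𝓡 n) ∞ a x) (h : ∀ᶠ z in 𝓝 y, a (b z) = z) :
    Function.Surjective (mfderiv (𝓡 n) (𝓡 n) a x) := by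
  subst hba
  have hd := mfderiv_comp y (ha.mdifferentiableAt (by simp)) (hb.mdifferentiableAt (by simp))
  have hid : mfderiv (𝓡 n) (𝓡 n) (a ∘ b) y = ContinuousLinearMap.id ℝ _ := by
    rw [Filter.EventuallyEq.mfderiv_eq (f := id) (by filter_upwards [h] with z hz using hz)]
    exact mfderiv_id
  intro c
  refine ⟨mfderiv (𝓡 n) (𝓡 n) b y c, ?_⟩
  have h2 := congrArg (fun L => L c) (hd.symm.trans hid)
  exact h2

theorem submersion_src (g : GermArrow n p) :
    Function.Surjective (mfderiv (𝓡 n) (𝓡 n) (src : GermArrow n p → M) g) := by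
  obtain ⟨f, hf, x, hx, rfl⟩ := g.exists_eq_of
  refine surjective_mfderiv_of_leftInverse (b := (sheetChart f hf).symm) (y := x)
    ((contMDiffOn_sheetChart_symm f hf).contMDiffAt (f.open_source.mem_nhds hx))
    (sheetChart_symm_apply f hf hx) (contMDiff_src _) ?_
  filter_upwards [f.open_source.mem_nhds hx] with z hz
  exact (sheetChart f hf).right_inv hz

theorem submersion_tgt (g : GermArrow n p) :
    Function.Surjective (mfderiv (𝓡 n) (𝓡 n) (tgt : GermArrow n p → M) g) := by
  obtain ⟨f, hf, x, hx, rfl⟩ := g.exists_eq_of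
  have h1 : ContMDiffAt (𝓡 n) (𝓡 n) ∞ f.symm (f x) :=
    f.contMDiffOn_invFun.contMDiffAt (f.open_target.mem_nhds (f.map_source hx))
  have h2 : ContMDiffAt (𝓡 n) (𝓡 n) ∞ (sheetChart f hf).symm (f.symm (f x)) := by
    refine (contMDiffOn_sheetChart_symm f hf).contMDiffAt (f.open_source.mem_nhds ?_)
    exact f.map_target (f.map_source hx)
  refine surjective_mfderiv_of_leftInverse (b := (sheetChart f hf).symm ∘ f.symm) (y := f x)
    (h2.comp _ h1) ?_ (contMDiff_tgt _) ?_
  · have : f.symm (f x) = x := f.left_inv hx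
    simp only [Function.comp_apply]
    rw [this, sheetChart_symm_apply f hf hx]
  · filter_upwards [f.open_target.mem_nhds (f.map_source hx)] with z hz
    have hz' : f.symm z ∈ f.source := f.map_target hz
    simp only [Function.comp_apply]
    rw [sheetChart_symm_apply f hf hz']
    exact f.right_inv hz

theorem contMDiff_comp (g f : GermArrow n p) (h : g.src = f.tgt) :
    ∃ (O : Set (GermArrow n p × GermArrow n p))
      (F : GermArrow n p × GermArrow n p → GermArrow n p),
    IsOpen O ∧ (g, f) ∈ O ∧
    ContMDiffOn ((𝓡 n).prod (𝓡 n)) (𝓡 n) ∞ F O ∧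
    ∀ g' f' (h : src g' = tgt f'), (g', f') ∈ O → F (g', f') = comp g' f' h := by
  obtain ⟨a, ha, x, hx, rfl⟩ := f.exists_eq_of
  obtain ⟨b, hb, y, hy, rfl⟩ := g.exists_eq_of
  change y = a x at h
  subst h
  refine ⟨sheet b ×ˢ (sheet a ∩ src ⁻¹' (a.trans b : Transition n M).source),
    fun q => (sheetChart (a.trans b) (trans_mem ha hb)).symm q.2.src, ?_, ?_, ?_, ?_⟩
  · exact (isOpen_sheet hb).prod
      ((isOpen_sheet ha).inter ((a.trans b : Transition n M).open_source.preimage continuous_src))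
  · exact ⟨of_mem_sheet b hb _ hy, of_mem_sheet a ha _ hx, hx, hy⟩
  · refine (contMDiffOn_sheetChart_symm _ (trans_mem ha hb)).comp
      (contMDiff_src.comp contMDiff_snd).contMDiffOn ?_
    rintro ⟨g', f'⟩ ⟨-, -, h⟩
    exact h
  · rintro g' f' h ⟨hg, hf, hc⟩
    simp only at hg hf ⊢
    rw [sheetChart_symm_apply _ _ hc]
    have key : ∀ (k l : GermArrow n p) (h : k.src = l.tgt) (z : M)
        (hz : z ∈ (a.trans b : Transition n M).source), k = of b hb (a z) hz.2 →
        l = of a ha z hz.1 → of _ (trans_mem ha hb) z hz = comp k l h := by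
      rintro _ _ h z hz rfl rfl
      rfl
    refine key _ _ h _ hc ?_ (eq_of_of_mem_sheet ha hf)
    rw [eq_of_of_mem_sheet hb hg]
    exact of_eq_of (h.trans (tgt_eq_on_sheet ha hf)) EventuallyEq.rfl

end GermArrow

variable [IsManifold (𝓡 n) ∞ M] [T2Space M]

/-- The étale Lie groupoid of germs of the pseudogroup of all transitions over `p`. -/
def germGroupoid (n : ℕ) {M : Type w} [TopologicalSpace M]
    [ChartedSpace (EuclideanSpace ℝ (Fin n)) M] [IsManifold (𝓡 n) ∞ M] [T2Space M] (p : M → Q) :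
    LieGroupoid.{w} where
  dimObj := n
  dimArr := n
  Obj := M
  Arr := GermArrow n p
  src := GermArrow.src
  tgt := GermArrow.tgt
  comp := GermArrow.comp
  unit := GermArrow.unit n p
  inv := GermArrow.inv
  src_comp _ _ _ := rfl
  tgt_comp g f h := by
    obtain ⟨f, hf, x, hx, rfl⟩ := f.exists_eq_of
    obtain ⟨g, hg, y, hy, rfl⟩ := g.exists_eq_of
    change y = f x at h
    subst h
    rfl
  comp_assoc k g f hkg hgf := by
    obtain ⟨f, hf, x, hx, rfl⟩ := f.exists_eq_of
    obtain ⟨g, hg, y, hy, rfl⟩ := g.exists_eq_of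
    obtain ⟨k, hk, z, hz, rfl⟩ := k.exists_eq_of
    change y = f x at hgf
    subst hgf
    change z = g (f x) at hkg
    subst hkg
    rfl
  src_unit _ := rfl
  tgt_unit _ := rfl
  unit_comp f := by
    obtain ⟨f, hf, x, hx, rfl⟩ := f.exists_eq_of
    rfl
  comp_unit f := by
    obtain ⟨f, hf, x, hx, rfl⟩ := f.exists_eq_of
    rfl
  src_inv _ := rfl
  tgt_inv := GermArrow.tgt_inv
  comp_inv g := by
    obtain ⟨f, hf, x, hx, rfl⟩ := g.exists_eq_of
    have hx' : f.symm (f x) ∈ f.source := f.map_target (f.map_source hx)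
    have key : ∀ (l k : GermArrow n p) (h : l.src = k.tgt),
        l = GermArrow.of f hf (f.symm (f x)) hx' →
        k = GermArrow.of f.symm (GermArrow.symm_mem hf) (f x) (f.map_source hx) →
        GermArrow.comp l k h = GermArrow.unit n p (f x) := by
      rintro _ _ h rfl rfl
      have e2 := GermArrow.comp_of (GermArrow.symm_mem hf) hf (f x) (f.map_source hx) hx'
      refine e2.trans (GermArrow.of_eq_of rfl ?_)
      filter_upwards [f.open_target.mem_nhds (f.map_source hx)] with z hz
      exact f.right_inv hz
    exact key _ _ _ (GermArrow.of_eq_of (f.left_inv hx).symm EventuallyEq.rfl)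
      (GermArrow.inv_of f hf x hx)
  inv_comp g := by
    obtain ⟨f, hf, x, hx, rfl⟩ := g.exists_eq_of
    have key : ∀ (k : GermArrow n p) (h : k.src = (GermArrow.of f hf x hx).tgt),
        k = GermArrow.of f.symm (GermArrow.symm_mem hf) (f x) (f.map_source hx) →
        GermArrow.comp k (GermArrow.of f hf x hx) h = GermArrow.unit n p x := by
      rintro _ h rfl
      have e2 := GermArrow.comp_of hf (GermArrow.symm_mem hf) x hx (f.map_source hx)
      refine e2.trans (GermArrow.of_eq_of rfl ?_)
      filter_upwards [f.open_source.mem_nhds hx] with z hz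
      exact f.left_inv hz
    exact key _ _ (GermArrow.inv_of f hf x hx)
  contMDiff_src := GermArrow.contMDiff_src
  contMDiff_tgt := GermArrow.contMDiff_tgt
  submersion_src := GermArrow.submersion_src
  submersion_tgt := GermArrow.submersion_tgt
  contMDiff_comp := GermArrow.contMDiff_comp
  contMDiff_unit := GermArrow.contMDiff_unit
  contMDiff_inv := GermArrow.contMDiff_inv

end Germs

/-! ### Reduced orbifolds -/

/-- The orbit equivalence relation on `V` of a group `G` of homeomorphisms of `V`. -/
def orbitRelation {V : Type u} [TopologicalSpace V] (G : Subgroup (V ≃ₜ V)) : Setoid V where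
  r x y := ∃ g ∈ G, g x = y
  iseqv :=
    { refl := fun x => ⟨1, G.one_mem, rfl⟩
      symm := by
        rintro x y ⟨g, hg, rfl⟩
        exact ⟨g⁻¹, G.inv_mem hg, g.symm_apply_apply x⟩
      trans := by
        rintro x y z ⟨g, hg, rfl⟩ ⟨k, hk, rfl⟩
        exact ⟨k * g, G.mul_mem hk hg, rfl⟩ }

/-- Reduced orbifold charts `(V, G, π)` of dimension `n` on `Q`: a connected `n`-manifold `V`, a
finite group `G` of diffeomorphisms of `V`, and a map `π : V → Q` with open image which induces a
homeomorphism `G\V → π(V)`. -/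
structure OrbifoldChart (Q : Type u) [TopologicalSpace Q] (n : ℕ) where
  V : Type u
  [topV : TopologicalSpace V]
  [t2V : T2Space V]
  [secondCountableV : SecondCountableTopology V]
  [connectedV : ConnectedSpace V]
  [chartedV : ChartedSpace (EuclideanSpace ℝ (Fin n)) V]
  [manifoldV : IsManifold (𝓡 n) ∞ V]
  G : Subgroup (V ≃ₜ V)
  finite_G : Finite G
  smooth_G : ∀ g ∈ G, ContMDiff (𝓡 n) (𝓡 n) ∞ g
  proj : V → Q
  isOpen_range_proj : IsOpen (range proj)
  quotient_homeo : ∃ e : Quotient (orbitRelation G) ≃ₜ range proj,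
    ∀ x : V, (e (Quotient.mk (orbitRelation G) x) : Q) = proj x

attribute [instance] OrbifoldChart.topV OrbifoldChart.t2V OrbifoldChart.secondCountableV
  OrbifoldChart.connectedV OrbifoldChart.chartedV OrbifoldChart.manifoldV

variable {Q : Type u} [TopologicalSpace Q] {n : ℕ}

namespace OrbifoldChart

/-- Two charts are compatible if points with the same image in `Q` are always related by a
diffeomorphism between open neighborhoods (a change of charts) which commutes with the
projections to `Q`. -/
def Compatible (c d : OrbifoldChart Q n) : Prop :=
  ∀ (x : c.V) (y : d.V), c.proj x = d.proj y →
    ∃ h : PartialDiffeomorph (𝓡 n) (𝓡 n) c.V d.V ∞,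
      x ∈ h.source ∧ h x = y ∧ ∀ z ∈ h.source, d.proj (h z) = c.proj z

theorem continuous_proj (c : OrbifoldChart Q n) : Continuous c.proj := by
  obtain ⟨e, he⟩ := c.quotient_homeo
  have : c.proj = fun x => (e (Quotient.mk (orbitRelation c.G) x) : Q) := funext fun x =>
    (he x).symm
  rw [this]
  exact continuous_subtype_val.comp (e.continuous.comp continuous_quot_mk)

theorem isOpenMap_proj (c : OrbifoldChart Q n) : IsOpenMap c.proj := by
  obtain ⟨e, he⟩ := c.quotient_homeo
  have h : c.proj = Subtype.val ∘ e ∘ Quotient.mk (orbitRelation c.G) := funext fun x =>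
    (he x).symm
  rw [h]
  refine (c.isOpen_range_proj.isOpenMap_subtype_val).comp (e.isOpenMap.comp ?_)
  intro O hO
  refine isOpen_coinduced.2 ?_
  have : Quotient.mk (orbitRelation c.G) ⁻¹' (Quotient.mk (orbitRelation c.G) '' O) =
      ⋃ g ∈ c.G, (g : c.V → c.V) ⁻¹' O := by
    ext x
    simp only [mem_preimage, mem_image, mem_iUnion]
    constructor
    · rintro ⟨y, hy, hxy⟩
      obtain ⟨g, hg, hgx⟩ := Quotient.exact hxy.symm
      exact ⟨g, hg, by rwa [hgx]⟩
    · rintro ⟨g, hg, hx⟩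
      have hr : (orbitRelation c.G) x (g x) := ⟨g, hg, rfl⟩
      exact ⟨g x, hx, (Quotient.sound hr).symm⟩
  change IsOpen (Quotient.mk (orbitRelation c.G) ⁻¹' (Quotient.mk (orbitRelation c.G) '' O))
  rw [this]
  exact isOpen_biUnion fun g _ => hO.preimage g.continuous

end OrbifoldChart

/-- Reduced orbifold atlases of dimension `n` on `Q`: sets of pairwise compatible orbifold charts
whose images cover `Q`. -/
structure OrbifoldAtlas (Q : Type u) [TopologicalSpace Q] (n : ℕ) where
  charts : Set (OrbifoldChart Q n)
  compatible : ∀ c ∈ charts, ∀ d ∈ charts, c.Compatible d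
  covers : ∀ q : Q, ∃ c ∈ charts, q ∈ range c.proj

/-- Reduced orbifold structures of dimension `n` on `Q`: maximal orbifold atlases. -/
structure OrbifoldStructure (Q : Type u) [TopologicalSpace Q] (n : ℕ) extends
    OrbifoldAtlas Q n where
  maximal : ∀ 𝒱 : OrbifoldAtlas Q n, charts ⊆ 𝒱.charts → 𝒱.charts ⊆ charts

namespace OrbifoldAtlas

/-- The atlas `𝒱` represents the orbifold structure `𝒰` if it is contained in `𝒰`. -/
def Represents (𝒱 : OrbifoldAtlas Q n) (𝒰 : OrbifoldStructure Q n) : Prop :=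
  𝒱.charts ⊆ 𝒰.charts

/-- The manifold `V = ∐ V_i`, the disjoint union of all charts of the atlas. -/
def Total (𝒱 : OrbifoldAtlas Q n) : Type (u + 1) := Σ c : 𝒱.charts, c.1.V

instance (𝒱 : OrbifoldAtlas Q n) : TopologicalSpace 𝒱.Total :=
  inferInstanceAs (TopologicalSpace (Σ c : 𝒱.charts, c.1.V))

instance (𝒱 : OrbifoldAtlas Q n) : T2Space 𝒱.Total :=
  inferInstanceAs (T2Space (Σ c : 𝒱.charts, c.1.V))

instance (𝒱 : OrbifoldAtlas Q n) : ChartedSpace (EuclideanSpace ℝ (Fin n)) 𝒱.Total :=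
  sigmaCharts (V := fun c : 𝒱.charts => c.1.V)

instance (𝒱 : OrbifoldAtlas Q n) : IsManifold (𝓡 n) ∞ 𝒱.Total :=
  sigmaCharts_isManifold (V := fun c : 𝒱.charts => c.1.V)

/-- The map `π = ∐ π_i : V → Q`. -/
def proj (𝒱 : OrbifoldAtlas Q n) (x : 𝒱.Total) : Q := x.1.1.proj x.2

/-- The atlas groupoid `Γ(𝒱)`. -/
def groupoid (𝒱 : OrbifoldAtlas Q n) : LieGroupoid.{u + 1} := germGroupoid n 𝒱.proj

theorem continuous_proj (𝒱 : OrbifoldAtlas Q n) : Continuous 𝒱.proj :=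
  continuous_sigma fun c : 𝒱.charts => c.1.continuous_proj

theorem isOpenMap_proj (𝒱 : OrbifoldAtlas Q n) : IsOpenMap 𝒱.proj :=
  isOpenMap_sigma.2 fun c : 𝒱.charts => c.1.isOpenMap_proj

theorem surjective_proj (𝒱 : OrbifoldAtlas Q n) : Function.Surjective 𝒱.proj := fun q => by
  obtain ⟨c, hc, x, hx⟩ := 𝒱.covers q
  exact ⟨⟨⟨c, hc⟩, x⟩, hx⟩

/-- Points of `V` with the same image in `Q` are joined by an arrow of `Γ(𝒱)`. -/
theorem exists_arrow (𝒱 : OrbifoldAtlas Q n) {x y : 𝒱.Total} (hxy : 𝒱.proj x = 𝒱.proj y) :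
    ∃ g : 𝒱.groupoid.Arr, 𝒱.groupoid.src g = x ∧ 𝒱.groupoid.tgt g = y := by
  obtain ⟨c, x⟩ := x
  obtain ⟨d, y⟩ := y
  obtain ⟨h, hx, hy, hp⟩ := 𝒱.compatible c.1 c.2 d.1 d.2 x y hxy
  let a : PartialDiffeomorph (𝓡 n) (𝓡 n) c.1.V 𝒱.Total ∞ :=
    sigmaInclusion (V := fun c : 𝒱.charts => c.1.V) c
  let b : PartialDiffeomorph (𝓡 n) (𝓡 n) d.1.V 𝒱.Total ∞ :=
    sigmaInclusion (V := fun c : 𝒱.charts => c.1.V) d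
  have ha : ∀ z, a.symm (⟨c, z⟩ : 𝒱.Total) = z := fun z => a.left_inv (mem_univ z)
  have hat : ∀ z, (⟨c, z⟩ : 𝒱.Total) ∈ a.target := fun z => a.map_source (mem_univ z)
  let f : Transition n 𝒱.Total := a.symm.trans (h.trans b)
  have hf : f ∈ liftPseudogroup n 𝒱.proj := by
    rintro z ⟨hz, hz2, -⟩
    obtain ⟨w, -, rfl⟩ : ∃ w, w ∈ a.source ∧ a w = z := ⟨_, a.map_target hz, a.right_inv hz⟩
    change 𝒱.proj ⟨d, h (a.symm ⟨c, w⟩)⟩ = c.1.proj w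
    change a.symm ⟨c, w⟩ ∈ h.source at hz2
    rw [ha] at hz2 ⊢
    exact hp w hz2
  have hxf : (⟨c, x⟩ : 𝒱.Total) ∈ f.source := by
    refine ⟨hat x, ?_, mem_univ _⟩
    change a.symm ⟨c, x⟩ ∈ h.source
    rwa [ha]
  refine ⟨GermArrow.of f hf ⟨c, x⟩ hxf, rfl, ?_⟩
  change (⟨d, h (a.symm ⟨c, x⟩)⟩ : 𝒱.Total) = ⟨d, y⟩
  rw [ha, hy]

theorem proj_eq_iff (𝒱 : OrbifoldAtlas Q n) {x y : 𝒱.Total} :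
    𝒱.groupoid.orbitSetoid x y ↔ 𝒱.proj x = 𝒱.proj y := by
  constructor
  · rintro ⟨g, rfl, rfl⟩
    exact (GermArrow.proj_tgt (n := n) (p := 𝒱.proj) g).symm
  · exact 𝒱.exists_arrow

/-- The homeomorphism `α_𝒱 : |Γ(𝒱)| → Q`, `[x] ↦ π(x)`. -/
def marking (𝒱 : OrbifoldAtlas Q n) : 𝒱.groupoid.OrbitSpace ≃ₜ Q :=
  Equiv.toHomeomorphOfContinuousOpen
    (Equiv.ofBijective
      (Quotient.lift (s := 𝒱.groupoid.orbitSetoid) 𝒱.proj fun _ _ h => 𝒱.proj_eq_iff.1 h)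
      ⟨by
        rintro ⟨x⟩ ⟨y⟩ h
        exact Quotient.sound (s := 𝒱.groupoid.orbitSetoid) (𝒱.proj_eq_iff.2 h), by
        intro q
        obtain ⟨x, hx⟩ := 𝒱.surjective_proj q
        exact ⟨Quotient.mk _ x, hx⟩⟩)
    (𝒱.continuous_proj.quotient_lift _)
    (by
      intro O hO
      have h := 𝒱.isOpenMap_proj _ (hO.preimage (continuous_quot_mk (X := 𝒱.groupoid.Obj)
        (r := 𝒱.groupoid.orbitSetoid)))
      convert h using 1
      ext q
      constructor
      · rintro ⟨⟨x⟩, hx, rfl⟩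
        exact ⟨x, hx, rfl⟩
      · rintro ⟨x, hx, rfl⟩
        exact ⟨_, hx, rfl⟩)

theorem marking_mk (𝒱 : OrbifoldAtlas Q n) (x : 𝒱.Total) :
    𝒱.marking (Quotient.mk 𝒱.groupoid.orbitSetoid x) = 𝒱.proj x := rfl

/-- The marked groupoid `(Γ(𝒱), α_𝒱, Q)`. -/
def markedGroupoid (𝒱 : OrbifoldAtlas Q n) : MarkedLieGroupoid.{u, u + 1} Q where
  toLieGroupoid := 𝒱.groupoid
  marking := 𝒱.marking

end OrbifoldAtlas

/-! ### Marked atlas groupoids and unit Morita equivalence -/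

/-- Marked atlas groupoids over `Q`: the marked Lie groupoids of the form `(Γ(𝒱), α_𝒱, Q)` for
some orbifold atlas `𝒱` (of any dimension) on `Q`. -/
def MarkedAtlasGroupoid (Q : Type u) [TopologicalSpace Q] : Type (u + 2) :=
  {M : MarkedLieGroupoid.{u, u + 1} Q //
    ∃ (n : ℕ) (𝒱 : OrbifoldAtlas Q n), M = 𝒱.markedGroupoid}

/-- The marked atlas groupoid `(Γ(𝒱), α_𝒱, Q)`. -/
def OrbifoldAtlas.markedAtlasGroupoid (𝒱 : OrbifoldAtlas Q n) : MarkedAtlasGroupoid Q :=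
  ⟨𝒱.markedGroupoid, n, 𝒱, rfl⟩

namespace MarkedAtlasGroupoid

/-- Homomorphisms of marked atlas groupoids are homomorphisms of the underlying Lie groupoids. -/
abbrev Hom (A B : MarkedAtlasGroupoid Q) : Type (u + 1) :=
  LieGroupoid.Hom A.1.toLieGroupoid B.1.toLieGroupoid

/-- A unit weak equivalence `φ : (G₁, α₁, Q) → (G₂, α₂, Q)` is a weak equivalence with
`α₂ ∘ |φ| ∘ α₁⁻¹ = id`. -/
structure Hom.IsUnitWeakEquivalence {A B : MarkedAtlasGroupoid Q} (φ : Hom A B) : Prop where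
  isWeakEquivalence : LieGroupoid.Hom.IsWeakEquivalence φ
  unit : ∀ q : Q, B.1.marking (LieGroupoid.Hom.orbitMap φ (A.1.marking.symm q)) = q

/-- `A` and `B` are unit Morita equivalent if there are a marked atlas groupoid `K` and unit weak
equivalences `A ← K → B`. -/
def UnitMoritaEquivalent (A B : MarkedAtlasGroupoid Q) : Prop :=
  ∃ (K : MarkedAtlasGroupoid Q) (φ : Hom K A) (ψ : Hom K B),
    φ.IsUnitWeakEquivalence ∧ ψ.IsUnitWeakEquivalence

end MarkedAtlasGroupoid

/-- `Γ(Q, 𝒰)`: the set of all `(Γ(𝒱), α_𝒱, Q)`, where `𝒱` is a representative of `𝒰`. -/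
def OrbifoldStructure.markedAtlasGroupoids (𝒰 : OrbifoldStructure Q n) :
    Set (MarkedAtlasGroupoid Q) :=
  {A | ∃ 𝒱 : OrbifoldAtlas Q n, 𝒱.Represents 𝒰 ∧ A = 𝒱.markedAtlasGroupoid}

end ReducedOrbifold

end

/-! Unit Morita equivalence of atlas groupoids is really a relation between atlases. Call `𝒱` and
`𝒲` related (`Related`) if any two points of their total spaces over the same point of `Q` are
joined by a diffeomorphism of neighborhoods over `Q`. The core is
`unitMoritaEquivalent_iff_related`: the groupoids are unit Morita equivalent exactly when the
atlases are related.

From equivalence to relatedness: the base map of a weak equivalence of germ groupoids is a local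
diffeomorphism (`isLocalDiffeomorph_obj_of_isWeakEquivalence`). The submersion condition makes its
derivative surjective, since source and target are étale. The fibered product condition makes its
fibers discrete: a point `y` near `x` with the same image is joined to `x` by an arrow over a unit;
this arrow is close to the unit at `x`, hence an identity germ, and `y = x`. The unit condition puts
the base map over `Q`, and a local diffeomorphism over `Q` relates the two atlases.

From relatedness to equivalence: a local diffeomorphism over `Q` acts on germs by conjugation, and
this is a unit weak equivalence (`exists_isUnitWeakEquivalence`). Related atlases have a common
refinement mapping to both by such local diffeomorphisms, because every chart contains arbitrarily
small charts around each of its points (`OrbifoldChart.exists_restriction`).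

Relatedness is an equivalence relation, which gives (1). For (2), related atlases over a non-empty
space have equal dimension, and a maximal atlas contains every atlas related to it, since the union
of the two is again an atlas. -/

noncomputable section

namespace ReducedOrbifold

/-! ### Submersions with isolated fiber points, and the inverse function theorem. -/

section LocalDiffeo

variable {E F : Type*} [NormedAddCommGroup E] [NormedSpace ℝ E] [FiniteDimensional ℝ E]
  [NormedAddCommGroup F] [NormedSpace ℝ F]

/-- A surjective strict derivative at a point which is isolated in its fiber is injective. -/
theorem injective_of_hasStrictFDerivAt_of_isolated [FiniteDimensional ℝ F] {f : E → F} {f' : E →L[ℝ] F} {a : E}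
    (hf : HasStrictFDerivAt f f' a) (hf' : f'.range = ⊤)
    (hiso : ∀ᶠ y in 𝓝 a, f y = f a → y = a) : Function.Injective f' := by
  refine (injective_iff_map_eq_zero f').2 ?_
  intro v hv
  -- The implicit function chart `e` has `f` as first component and straightens the fiber of `f`
  -- through `a`. For `v` in the kernel, `t ↦ e.symm (f a, t • v)` is therefore a path in that
  -- fiber; isolation of `a` makes it constant for small `t`, so `t • v = 0` for some `t ≠ 0`.
  set e := hf.implicitToOpenPartialHomeomorph f f' hf' with he
  have hea : e a = (f a, 0) := hf.implicitToOpenPartialHomeomorph_self hf'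
  have has : a ∈ e.source := hf.mem_implicitToOpenPartialHomeomorph_source hf'
  have hat : (f a, (0 : f'.ker)) ∈ e.target := hea ▸ e.map_source has
  have hsymm : e.symm (f a, 0) = a := by rw [← hea, e.left_inv has]
  have hc : Tendsto (fun t : ℝ => (f a, t • (⟨v, hv⟩ : f'.ker))) (𝓝 0) (𝓝 (f a, 0)) := by
    have : Continuous (fun t : ℝ => (f a, t • (⟨v, hv⟩ : f'.ker))) := by fun_prop
    simpa using this.tendsto 0
  have hc2 : Tendsto (fun t : ℝ => e.symm (f a, t • (⟨v, hv⟩ : f'.ker))) (𝓝 0) (𝓝 a) := by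
    have h := (e.continuousAt_symm hat).tendsto
    rw [hsymm] at h
    exact h.comp hc
  have hev : ∀ᶠ t : ℝ in 𝓝 0, t • v = 0 := by
    filter_upwards [hc2.eventually hiso, hc.eventually (e.open_target.mem_nhds hat)] with t ht htt
    have h1 := e.right_inv htt
    have h2 : f (e.symm (f a, t • (⟨v, hv⟩ : f'.ker))) = f a := by
      have := hf.implicitToOpenPartialHomeomorph_fst hf' (e.symm (f a, t • (⟨v, hv⟩ : f'.ker)))
      rw [← this]
      exact congrArg Prod.fst h1
    rw [ht h2, hea] at h1
    have h3 := congrArg (fun q => (q.2 : E)) h1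
    simpa using h3.symm
  obtain ⟨t, ht, h0⟩ := (hev.filter_mono nhdsWithin_le_nhds |>.and
    (self_mem_nhdsWithin : {(0 : ℝ)}ᶜ ∈ 𝓝[≠] (0 : ℝ))).exists
  exact (smul_eq_zero.1 ht).resolve_left h0

/-- The inverse function theorem for maps that are smooth on an open set. -/
theorem exists_openPartialHomeomorph_of_contDiffOn {f : E → F} {s : Set E} {a : E}
    (hs : IsOpen s) (ha : a ∈ s) (hf : ContDiffOn ℝ ∞ f s)
    (hbij : Function.Bijective (fderiv ℝ f a)) :
    ∃ ψ : OpenPartialHomeomorph E F, a ∈ ψ.source ∧ ψ.source ⊆ s ∧ (ψ : E → F) = f ∧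
      ContDiffOn ℝ ∞ ψ.symm ψ.target := by
  let A : E ≃L[ℝ] F := (LinearEquiv.ofBijective (fderiv ℝ f a : E →ₗ[ℝ] F) hbij).toContinuousLinearEquiv
  have hA : (A : E →L[ℝ] F) = fderiv ℝ f a := by ext; rfl
  have hfa : ContDiffAt ℝ ∞ f a := hf.contDiffAt (hs.mem_nhds ha)
  have hd : HasFDerivAt f (A : E →L[ℝ] F) a := by
    rw [hA]; exact (hfa.differentiableAt (by simp)).hasFDerivAt
  let ψ := hfa.toOpenPartialHomeomorph f hd (by simp)
  have hcont : ContinuousOn (fderiv ℝ f) s := hf.continuousOn_fderiv_of_isOpen hs (by simp)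
  -- Shrinking to the points with invertible derivative makes the inverse smooth on the whole
  -- target, not only at `f a`.
  have hopen : IsOpen (s ∩ fderiv ℝ f ⁻¹' range ((↑) : (E ≃L[ℝ] F) → (E →L[ℝ] F))) :=
    hcont.isOpen_inter_preimage hs ContinuousLinearEquiv.isOpen
  refine ⟨ψ.restrOpen _ hopen, ⟨hfa.mem_toOpenPartialHomeomorph_source hd (by simp), ha, A, hA⟩,
    fun x hx => hx.2.1, rfl, ?_⟩
  intro y hy
  refine ContDiffAt.contDiffWithinAt ?_
  have hy' := (ψ.restrOpen _ hopen).map_target hy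
  obtain ⟨-, hys, B, hB⟩ := hy'
  have hyc := hf.contDiffAt (hs.mem_nhds hys)
  refine (ψ.restrOpen _ hopen).contDiffAt_symm (f₀' := B) hy ?_ hyc
  rw [hB]
  exact (hyc.differentiableAt (by simp)).hasFDerivAt

end LocalDiffeo

/-! ### Local diffeomorphisms of manifolds. -/

section Manifolds

variable {n m k : ℕ} {M : Type u} {N : Type v} {P : Type w} [TopologicalSpace M]
  [TopologicalSpace N] [TopologicalSpace P]
  [ChartedSpace (EuclideanSpace ℝ (Fin n)) M] [ChartedSpace (EuclideanSpace ℝ (Fin m)) N]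
  [ChartedSpace (EuclideanSpace ℝ (Fin k)) P]

/-- The restriction of a partial diffeomorphism to an open set. -/
def restrDiffeo (f : PartialDiffeomorph (𝓡 n) (𝓡 m) M N ∞) (O : Set M) (hO : IsOpen O) :
    PartialDiffeomorph (𝓡 n) (𝓡 m) M N ∞ where
  toPartialEquiv := (f.toOpenPartialHomeomorph.restrOpen O hO).toPartialEquiv
  open_source := (f.toOpenPartialHomeomorph.restrOpen O hO).open_source
  open_target := (f.toOpenPartialHomeomorph.restrOpen O hO).open_target
  contMDiffOn_toFun := f.contMDiffOn_toFun.mono (fun _ hx => hx.1)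
  contMDiffOn_invFun := f.contMDiffOn_invFun.mono (fun _ hx => hx.1)

theorem isLocalDiffeomorphAt_congr {f g : M → N} {x : M}
    (hf : IsLocalDiffeomorphAt (𝓡 n) (𝓡 m) ∞ f x) (h : g =ᶠ[𝓝 x] f) :
    IsLocalDiffeomorphAt (𝓡 n) (𝓡 m) ∞ g x := by
  obtain ⟨e, hx, he⟩ := hf
  obtain ⟨O, hO, hOo, hxO⟩ := mem_nhds_iff.1 h
  exact ⟨restrDiffeo e O hOo, ⟨hx, hxO⟩, fun z hz => (hO hz.2).trans (he hz.1)⟩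

theorem isLocalDiffeomorph_comp {f : M → N} {g : N → P}
    (hg : IsLocalDiffeomorph (𝓡 m) (𝓡 k) ∞ g) (hf : IsLocalDiffeomorph (𝓡 n) (𝓡 m) ∞ f) :
    IsLocalDiffeomorph (𝓡 n) (𝓡 k) ∞ (g ∘ f) :=
  fun x => (hf x).comp (𝓡 k) P (hg (f x))

/-- Smoothness of a continuous map can be checked after composition with a local
diffeomorphism. -/
theorem contMDiff_of_comp_isLocalDiffeomorph {f : M → N} {g : N → P} (hf : Continuous f)
    (hg : IsLocalDiffeomorph (𝓡 m) (𝓡 k) ∞ g) (h : ContMDiff (𝓡 n) (𝓡 k) ∞ (g ∘ f)) :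
    ContMDiff (𝓡 n) (𝓡 m) ∞ f := by
  intro x
  -- Near `x`, `f` is the local inverse of `g` applied to `g ∘ f`; continuity of `f` keeps its
  -- values where this inverse is valid.
  have h1 := ((hg (f x)).localInverse_contMDiffAt).comp x (h x)
  refine h1.congr_of_eventuallyEq ?_
  filter_upwards [hf.continuousAt.eventually (hg (f x)).localInverse_eventuallyEq_left] with z hz
  exact hz.symm

theorem isLocalDiffeomorphAt_chart [IsManifold (𝓡 n) ∞ M] {x y : M}
    (hx : x ∈ (chartAt (EuclideanSpace ℝ (Fin n)) y).source) :
    IsLocalDiffeomorphAt (𝓡 n) (𝓡 n) ∞ (chartAt (EuclideanSpace ℝ (Fin n)) y) x := by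
  have h := IsManifold.chart_mem_maximalAtlas (I := 𝓡 n) (n := ∞) y
  exact ⟨⟨(chartAt (EuclideanSpace ℝ (Fin n)) y).toPartialEquiv,
    (chartAt (EuclideanSpace ℝ (Fin n)) y).open_source,
    (chartAt (EuclideanSpace ℝ (Fin n)) y).open_target,
    contMDiffOn_of_mem_maximalAtlas h, contMDiffOn_symm_of_mem_maximalAtlas h⟩, hx,
    fun _ _ => rfl⟩

theorem isLocalDiffeomorphAt_chart_symm [IsManifold (𝓡 n) ∞ M] {y : M}
    {x : EuclideanSpace ℝ (Fin n)} (hx : x ∈ (chartAt (EuclideanSpace ℝ (Fin n)) y).target) :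
    IsLocalDiffeomorphAt (𝓡 n) (𝓡 n) ∞ (chartAt (EuclideanSpace ℝ (Fin n)) y).symm x := by
  have h := IsManifold.chart_mem_maximalAtlas (I := 𝓡 n) (n := ∞) y
  exact ⟨⟨(chartAt (EuclideanSpace ℝ (Fin n)) y).toPartialEquiv.symm,
    (chartAt (EuclideanSpace ℝ (Fin n)) y).open_target,
    (chartAt (EuclideanSpace ℝ (Fin n)) y).open_source,
    contMDiffOn_symm_of_mem_maximalAtlas h, contMDiffOn_of_mem_maximalAtlas h⟩, hx,
    fun _ _ => rfl⟩

theorem bijective_mfderiv {f : M → N} {x : M}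
    (hf : IsLocalDiffeomorphAt (𝓡 n) (𝓡 m) ∞ f x) :
    Function.Bijective (mfderiv (𝓡 n) (𝓡 m) f x) :=
  (hf.mfderivToContinuousLinearEquiv (by simp)).bijective

theorem surjective_mfderiv_comp {f : M → N} {g : N → P} {x : M}
    (hg : MDifferentiableAt (𝓡 m) (𝓡 k) g (f x)) (hf : MDifferentiableAt (𝓡 n) (𝓡 m) f x)
    (hgs : Function.Surjective (mfderiv (𝓡 m) (𝓡 k) g (f x)))
    (hfs : Function.Surjective (mfderiv (𝓡 n) (𝓡 m) f x)) :
    Function.Surjective (mfderiv (𝓡 n) (𝓡 k) (g ∘ f) x) := by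
  rw [mfderiv_comp x hg hf]
  exact hgs.comp hfs

/-- A submersion is a local diffeomorphism at every point isolated in its fiber. -/
theorem isLocalDiffeomorphAt_of_isolated [IsManifold (𝓡 n) ∞ M] [IsManifold (𝓡 m) ∞ N]
    {f : M → N} (hf : ContMDiff (𝓡 n) (𝓡 m) ∞ f) {x : M}
    (hsurj : Function.Surjective (mfderiv (𝓡 n) (𝓡 m) f x))
    (hiso : ∀ᶠ y in 𝓝 x, f y = f x → y = x) :
    IsLocalDiffeomorphAt (𝓡 n) (𝓡 m) ∞ f x := by
  set c := chartAt (EuclideanSpace ℝ (Fin n)) x with hc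
  set d := chartAt (EuclideanSpace ℝ (Fin m)) (f x) with hd
  have hxc : x ∈ c.source := mem_chart_source _ x
  have hcx : c.symm (c x) = x := c.left_inv hxc
  have hcxt : c x ∈ c.target := c.map_source hxc
  set s := c.target ∩ c.symm ⁻¹' (f ⁻¹' d.source) with hs
  have hso : IsOpen s := c.isOpen_inter_preimage_symm (d.open_source.preimage hf.continuous)
  have has : c x ∈ s := ⟨hcxt, by
    simp only [mem_preimage, hcx]; exact mem_chart_source _ (f x)⟩
  have hFs : ContDiffOn ℝ ∞ (d ∘ f ∘ c.symm) s := by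
    rw [← contMDiffOn_iff_contDiffOn]
    intro z hz
    refine ContMDiffAt.contMDiffWithinAt ?_
    exact (isLocalDiffeomorphAt_chart hz.2).contMDiffAt.comp z
      ((hf _).comp z (isLocalDiffeomorphAt_chart_symm hz.1).contMDiffAt)
  have hsurjF : Function.Surjective (fderiv ℝ (d ∘ f ∘ c.symm) (c x)) := by
    rw [← mfderiv_eq_fderiv]
    have h1 := isLocalDiffeomorphAt_chart_symm (M := M) (n := n) hcxt
    have h2 := isLocalDiffeomorphAt_chart (M := N) (n := m) has.2
    refine surjective_mfderiv_comp (h2.mdifferentiableAt (by simp)) ?_ (bijective_mfderiv h2).2 ?_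
    · exact ((hf _).mdifferentiableAt (by simp)).comp _ (h1.mdifferentiableAt (by simp))
    · refine surjective_mfderiv_comp ((hf _).mdifferentiableAt (by simp))
        (h1.mdifferentiableAt (by simp)) ?_ (bijective_mfderiv h1).2
      rwa [hcx]
  have hisoF : ∀ᶠ y in 𝓝 (c x), (d ∘ f ∘ c.symm) y = (d ∘ f ∘ c.symm) (c x) → y = c x := by
    have h1 : ContinuousAt c.symm (c x) := c.continuousAt_symm hcxt
    rw [ContinuousAt, hcx] at h1
    filter_upwards [h1.eventually hiso, hso.mem_nhds has] with y hy hys hyF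
    have h2 := d.injOn hys.2 has.2 hyF
    rw [hcx] at h2
    rw [← hy h2, c.right_inv hys.1]
  have hFa := hFs.contDiffAt (hso.mem_nhds has)
  have hinj := injective_of_hasStrictFDerivAt_of_isolated
    (hFa.hasStrictFDerivAt (by simp)) (LinearMap.range_eq_top.2 hsurjF) hisoF
  obtain ⟨ψ, hψ, hψs, hψf, hψi⟩ :=
    exists_openPartialHomeomorph_of_contDiffOn hso has hFs ⟨hinj, hsurjF⟩
  have hψd : IsLocalDiffeomorphAt (𝓡 n) (𝓡 m) ∞ (d ∘ f ∘ c.symm) (c x) :=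
    ⟨⟨ψ.toPartialEquiv, ψ.open_source, ψ.open_target,
      contMDiffOn_iff_contDiffOn.2 (by
        have := hFs.mono hψs
        rwa [← hψf] at this), contMDiffOn_iff_contDiffOn.2 hψi⟩, hψ,
      fun z _ => (congrFun hψf z).symm⟩
  -- The local diffeomorphism property is carried back from the coordinate expression: near `x`, `f
  -- = d.symm ∘ (d ∘ f ∘ c.symm) ∘ c`.
  have h1 := hψd.comp (𝓡 m) N (g := d.symm) (isLocalDiffeomorphAt_chart_symm
    (by simp only [Function.comp_apply]; exact d.map_source has.2))
  have h2 := (isLocalDiffeomorphAt_chart hxc).comp (𝓡 m) N h1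
  refine isLocalDiffeomorphAt_congr h2 ?_
  filter_upwards [c.open_source.mem_nhds hxc,
    (d.open_source.preimage hf.continuous).mem_nhds (mem_chart_source _ (f x))] with z hz hz2
  simp only [Function.comp_apply, ← hc]
  rw [c.left_inv hz, d.left_inv hz2]

/-- The map along which a smooth structure is pulled back is a local diffeomorphism. -/
theorem pullbackCharts_isLocalDiffeomorph {M : Type u} [TopologicalSpace M] [IsManifold (𝓡 m) ∞ N]
    {p : M → N} (hp : IsLocalHomeomorph p) :
    letI := pullbackCharts (n := m) hp
    IsLocalDiffeomorph (𝓡 m) (𝓡 m) ∞ p := by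
  let _ := pullbackCharts (n := m) hp
  intro x
  obtain ⟨f, hx, hf⟩ := hp x
  have hf' : EqOn p f f.source := fun y _ => congrFun hf y
  exact ⟨⟨f.toPartialEquiv, f.open_source, f.open_target,
    (pullbackCharts_contMDiff (n := m) hp).contMDiffOn.congr fun z hz => (hf' hz).symm,
    pullbackCharts_contMDiffOn_symm hp f hf'⟩, hx, hf'⟩

end Manifolds

/-! ### Images of germs under a local diffeomorphism over `Q`. -/

section GermLifts

variable {n m : ℕ} {M : Type v} {N : Type w} {Q : Type u} [TopologicalSpace M]
  [TopologicalSpace N] [ChartedSpace (EuclideanSpace ℝ (Fin n)) M]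
  [ChartedSpace (EuclideanSpace ℝ (Fin m)) N] {p : M → Q} {q : N → Q} {φ : M → N}

/-- The arrow `k` over `q` is the image of the arrow `g` over `p` under `φ`, that is
`k ∘ φ = φ ∘ g` as germs at the source of `g`. -/
def IsGermImage (φ : M → N) (g : GermArrow n p) (k : GermArrow m q) : Prop :=
  ∃ (f : Transition n M) (hf : f ∈ liftPseudogroup n p) (x : M) (hx : x ∈ f.source)
    (f' : Transition m N) (hf' : f' ∈ liftPseudogroup m q) (hx' : φ x ∈ f'.source),
    g = GermArrow.of f hf x hx ∧ k = GermArrow.of f' hf' (φ x) hx' ∧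
      (f' : N → N) ∘ φ =ᶠ[𝓝 x] φ ∘ f

namespace IsGermImage

theorem src_eq {g : GermArrow n p} {k : GermArrow m q} (h : IsGermImage φ g k) :
    k.src = φ g.src := by
  obtain ⟨f, hf, x, hx, f', hf', hx', rfl, rfl, -⟩ := h
  rfl

theorem tgt_eq {g : GermArrow n p} {k : GermArrow m q} (h : IsGermImage φ g k) :
    k.tgt = φ g.tgt := by
  obtain ⟨f, hf, x, hx, f', hf', hx', rfl, rfl, h⟩ := h
  exact h.self_of_nhds

/-- The commutation relation does not depend on the representatives: equality of germs at `φ x`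
pulls back to a neighborhood of `x` by continuity. -/
theorem eventuallyEq {f : Transition n M} {hf : f ∈ liftPseudogroup n p} {x : M}
    {hx : x ∈ f.source} {f' : Transition m N} {hf' : f' ∈ liftPseudogroup m q} {y : N}
    {hy : y ∈ f'.source} (hφ : ContinuousAt φ x)
    (h : IsGermImage φ (GermArrow.of f hf x hx) (GermArrow.of f' hf' y hy)) :
    (f' : N → N) ∘ φ =ᶠ[𝓝 x] φ ∘ f := by
  obtain ⟨a, ha, z, hz, b, hb, hz', h1, h2, h3⟩ := h
  obtain rfl : x = z := congrArg GermArrow.src h1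
  obtain rfl : y = φ x := congrArg GermArrow.src h2
  have h4 : (f : M → M) =ᶠ[𝓝 x] a := by
    simp only [GermArrow.of, GermArrow.mk.injEq, heq_eq_eq, true_and] at h1
    exact Germ.coe_eq.1 h1
  have h5 : (f' : N → N) =ᶠ[𝓝 (φ x)] b := by
    simp only [GermArrow.of, GermArrow.mk.injEq, heq_eq_eq, true_and] at h2
    exact Germ.coe_eq.1 h2
  filter_upwards [h3, h4, hφ.eventually h5] with w hw1 hw2 hw3
  simp only [Function.comp_apply] at hw1 ⊢
  rw [hw3, hw1, hw2]

/-- A local diffeomorphism maps neighborhoods of `x` onto neighborhoods of `φ x`, so a germ at `φ x`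
is determined by its composite with `φ`. Identities for `germMap` thus reduce to exhibiting one
image. -/
theorem unique (hφ : IsLocalDiffeomorph (𝓡 n) (𝓡 m) ∞ φ) {g : GermArrow n p}
    {k k' : GermArrow m q} (h : IsGermImage φ g k) (h' : IsGermImage φ g k') : k = k' := by
  obtain ⟨f, hf, x, hx, f', hf', hx', rfl, rfl, h⟩ := h
  obtain ⟨f'', hf'', y, hy, rfl⟩ := k'.exists_eq_of
  obtain rfl : y = φ x := h'.src_eq
  have h2 := h'.eventuallyEq (hφ.contMDiff.continuous.continuousAt)
  refine GermArrow.of_eq_of rfl ?_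
  have h3 : ∀ᶠ z in 𝓝 x, (f' : N → N) (φ z) = f'' (φ z) := h.trans h2.symm
  have h4 : Filter.map φ (𝓝 x) = 𝓝 (φ x) := hφ.isLocalHomeomorph.map_nhds_eq x
  rw [Filter.EventuallyEq, ← h4]
  exact h3

theorem unit (x : M) :
    IsGermImage φ (GermArrow.unit n p x) (GermArrow.unit m q (φ x)) :=
  ⟨_, _, x, mem_univ x, _, GermArrow.refl_mem, mem_univ _, rfl, rfl, EventuallyEq.rfl⟩

theorem comp {g g' : GermArrow n p} {k k' : GermArrow m q}
    (h : IsGermImage φ g k) (h' : IsGermImage φ g' k') (hg : g'.src = g.tgt)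
    (hk : k'.src = k.tgt) : IsGermImage φ (GermArrow.comp g' g hg) (GermArrow.comp k' k hk) := by
  obtain ⟨f, hf, x, hx, a, ha, hx', rfl, rfl, h⟩ := h
  obtain ⟨f', hf', y, hy, a', ha', hy', rfl, rfl, h'⟩ := h'
  obtain rfl : y = f x := hg
  have hk' : φ (f x) = a (φ x) := hk
  have hy2 : a (φ x) ∈ a'.source := hk' ▸ hy'
  refine ⟨f.trans f', GermArrow.trans_mem hf hf', x, ⟨hx, hy⟩, a.trans a',
    GermArrow.trans_mem ha ha', ⟨hx', hy2⟩, rfl, ?_, ?_⟩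
  -- The base point `φ (f x)` of the second arrow equals `a (φ x)` only propositionally; a general
  -- arrow `l` absorbs the change of base point.
  · have key : ∀ (l : GermArrow m q) (hl : l.src = a (φ x)),
        l = GermArrow.of a' ha' (a (φ x)) hy2 →
        GermArrow.comp l (GermArrow.of a ha (φ x) hx') hl =
          GermArrow.of (a.trans a') (GermArrow.trans_mem ha ha') (φ x) ⟨hx', hy2⟩ := by
      rintro _ hl rfl
      rfl
    exact key _ hk (GermArrow.of_eq_of hk' EventuallyEq.rfl)
  · filter_upwards [h, (Transition.continuousAt f hx).eventually h'] with z hz hz'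
    exact (congrArg a' hz).trans hz'

theorem inv (hφ : Continuous φ) {g : GermArrow n p} {k : GermArrow m q}
    (h : IsGermImage φ g k) : IsGermImage φ g.inv k.inv := by
  obtain ⟨f, hf, x, hx, a, ha, hx', rfl, rfl, h⟩ := h
  have h0 : a (φ x) = φ (f x) := h.self_of_nhds
  have hm : φ (f x) ∈ a.target := h0 ▸ a.map_source hx'
  refine ⟨f.symm, GermArrow.symm_mem hf, f x, f.map_source hx, a.symm, GermArrow.symm_mem ha,
    hm, GermArrow.inv_of _ _ _ _, (GermArrow.inv_of _ _ _ _).trans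
      (GermArrow.of_eq_of h0 EventuallyEq.rfl), ?_⟩
  have hc : ContinuousAt f.symm (f x) := Transition.continuousAt f.symm (f.map_source hx)
  have hb : f.symm (f x) = x := f.left_inv hx
  rw [ContinuousAt, hb] at hc
  filter_upwards [hc.eventually h, hc.eventually
    (hφ.continuousAt.eventually (a.open_source.mem_nhds hx')),
    f.open_target.mem_nhds (f.map_source hx)] with z hz hz2 hz3
  have h1 : f (f.symm z) = z := f.right_inv hz3
  have h2 : a (φ (f.symm z)) = φ z := by
    have h3 : a (φ (f.symm z)) = φ (f (f.symm z)) := hz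
    rwa [h1] at h3
  have h3 : a.symm (a (φ (f.symm z))) = φ (f.symm z) := a.left_inv hz2
  rw [h2] at h3
  exact h3

end IsGermImage

/-- Locally, a transition of `M` over `p` descends along a local diffeomorphism `φ` to a
transition of `N` over `q`; moreover `φ` is injective around the image point. -/
theorem exists_descent (hφ : IsLocalDiffeomorph (𝓡 n) (𝓡 m) ∞ φ) (hp : ∀ x, q (φ x) = p x)
    {f : Transition n M} (hf : f ∈ liftPseudogroup n p) {x : M} (hx : x ∈ f.source) :
    ∃ f' ∈ liftPseudogroup m q, ∃ O : Set M, IsOpen O ∧ x ∈ O ∧ O ⊆ f.source ∧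
      (∀ z ∈ O, φ z ∈ f'.source ∧ f' (φ z) = φ (f z)) ∧
      ∃ O' : Set M, IsOpen O' ∧ InjOn φ O' ∧ ∀ z ∈ O, f z ∈ O' := by
  obtain ⟨e, hxe, he⟩ := hφ x
  obtain ⟨d, hxd, hd⟩ := hφ (f x)
  have hside : ∀ z ∈ e.source, e.symm (φ z) = z := fun z hz => by
    rw [he hz]; exact e.left_inv hz
  -- Here `e` and `d` are the branches of `φ` at `x` and at `f x`, and the descent is the conjugate
  -- `d ∘ f ∘ e⁻¹`. The set `O'` is the domain of `d`, where `φ` is injective.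
  refine ⟨e.symm.trans (f.trans d), ?_, e.source ∩ (f.trans d).source,
    e.open_source.inter (f.trans d).open_source, ⟨hxe, hx, hxd⟩, fun z hz => hz.2.1, ?_,
    d.source, d.open_source, ?_, fun z hz => hz.2.2⟩
  · rintro w ⟨hw1, hw2, hw3⟩
    obtain ⟨z, hz, rfl⟩ : ∃ z ∈ e.source, φ z = w :=
      ⟨e.symm w, e.map_target hw1, (he (e.map_target hw1)).trans (e.right_inv hw1)⟩
    change e.symm (φ z) ∈ f.source at hw2
    change f (e.symm (φ z)) ∈ d.source at hw3
    change q (d (f (e.symm (φ z)))) = q (φ z)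
    rw [hside z hz] at hw2 hw3 ⊢
    rw [← hd hw3, hp, hp, hf z hw2]
  · rintro z ⟨hz1, hz2, hz3⟩
    have h1 : e.symm (φ z) = z := hside z hz1
    refine ⟨⟨?_, ?_⟩, ?_⟩
    · change φ z ∈ e.target
      rw [he hz1]
      exact e.map_source hz1
    · change e.symm (φ z) ∈ (f.trans d).source
      rw [h1]
      exact ⟨hz2, hz3⟩
    · change d (f (e.symm (φ z))) = φ (f z)
      rw [h1]
      exact (hd hz3).symm
  · intro a ha b hb hab
    rw [hd ha, hd hb] at hab
    exact d.toPartialEquiv.injOn ha hb hab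

theorem exists_isGermImage (hφ : IsLocalDiffeomorph (𝓡 n) (𝓡 m) ∞ φ) (hp : ∀ x, q (φ x) = p x)
    (g : GermArrow n p) : ∃ k : GermArrow m q, IsGermImage φ g k := by
  obtain ⟨f, hf, x, hx, rfl⟩ := g.exists_eq_of
  obtain ⟨f', hf', O, hO, hxO, -, hOf, -⟩ := exists_descent hφ hp hf hx
  refine ⟨GermArrow.of f' hf' (φ x) (hOf x hxO).1, f, hf, x, hx, f', hf', _, rfl, rfl, ?_⟩
  filter_upwards [hO.mem_nhds hxO] with z hz using (hOf z hz).2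

/-- Arrows over `q` between points in the image of `φ` lift to arrows over `p`. -/
theorem exists_isGermImage_of_src_of_tgt (hφ : IsLocalDiffeomorph (𝓡 n) (𝓡 m) ∞ φ)
    (hp : ∀ x, q (φ x) = p x) (k : GermArrow m q) {x y : M} (hx : φ x = k.src)
    (hy : φ y = k.tgt) : ∃ g : GermArrow n p, g.src = x ∧ g.tgt = y ∧ IsGermImage φ g k := by
  obtain ⟨a, ha, w, hw, rfl⟩ := k.exists_eq_of
  obtain rfl : φ x = w := hx
  change φ y = a (φ x) at hy
  obtain ⟨e, hxe, he⟩ := hφ x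
  obtain ⟨d, hyd, hd⟩ := hφ y
  have hyt : a (φ x) ∈ d.target := by
    rw [← hy, hd hyd]; exact d.map_source hyd
  have hdside : ∀ z ∈ d.target, φ (d.symm z) = z := fun z hz =>
    (hd (d.map_target hz)).trans (d.right_inv hz)
  -- The lift is `a` conjugated by `φ`, with the branch of its inverse chosen at `y` so that `x`
  -- goes to `y`.
  let f : Transition n M := e.trans (a.trans d.symm)
  have hfs : ∀ z ∈ f.source, z ∈ e.source ∧ φ z ∈ a.source ∧ a (φ z) ∈ d.target := by
    rintro z ⟨hz1, hz2, hz3⟩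
    change e z ∈ a.source at hz2
    change a (e z) ∈ d.target at hz3
    rw [← he hz1] at hz2 hz3
    exact ⟨hz1, hz2, hz3⟩
  have hfa : ∀ z ∈ e.source, f z = d.symm (a (φ z)) := fun z hz => by
    change d.symm (a (e z)) = _
    rw [he hz]
  have hf : f ∈ liftPseudogroup n p := by
    intro z hz
    obtain ⟨h1, h2, h3⟩ := hfs z hz
    rw [hfa z h1, ← hp, hdside _ h3, ha _ h2, hp]
  have hxf : x ∈ f.source := by
    refine ⟨hxe, ?_, ?_⟩
    · change e x ∈ a.source
      rwa [← he hxe]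
    · change a (e x) ∈ d.target
      rwa [← he hxe]
  refine ⟨GermArrow.of f hf x hxf, rfl, ?_, f, hf, x, hxf, a, ha, hw, rfl, rfl, ?_⟩
  · change f x = y
    rw [hfa x hxe, ← hy, hd hyd]
    exact d.left_inv hyd
  · filter_upwards [f.open_source.mem_nhds hxf] with z hz
    obtain ⟨h1, h2, h3⟩ := hfs z hz
    simp only [Function.comp_apply]
    rw [hfa z h1, hdside _ h3]

/-- The map on arrows induced by a local diffeomorphism over `Q`. -/
def germMap (hφ : IsLocalDiffeomorph (𝓡 n) (𝓡 m) ∞ φ) (hp : ∀ x, q (φ x) = p x)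
    (g : GermArrow n p) : GermArrow m q :=
  (exists_isGermImage hφ hp g).choose

theorem isGermImage_germMap (hφ : IsLocalDiffeomorph (𝓡 n) (𝓡 m) ∞ φ) (hp : ∀ x, q (φ x) = p x)
    (g : GermArrow n p) : IsGermImage φ g (germMap hφ hp g) :=
  (exists_isGermImage hφ hp g).choose_spec

theorem germMap_eq_of (hφ : IsLocalDiffeomorph (𝓡 n) (𝓡 m) ∞ φ) (hp : ∀ x, q (φ x) = p x)
    {g : GermArrow n p} {k : GermArrow m q} (h : IsGermImage φ g k) : germMap hφ hp g = k :=
  (isGermImage_germMap hφ hp g).unique hφ h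

/-- A single descent `f'` computes the images of all germs of `f` at points of `O`. This uniformity
is what gives smoothness and the embedding property below. -/
theorem isGermImage_of_descent {f : Transition n M} (hf : f ∈ liftPseudogroup n p)
    {f' : Transition m N} (hf' : f' ∈ liftPseudogroup m q) {O : Set M} (hO : IsOpen O)
    (h : ∀ z ∈ O, φ z ∈ f'.source ∧ f' (φ z) = φ (f z)) {g : GermArrow n p}
    (hg : g ∈ GermArrow.sheet f) (hgO : g.src ∈ O) :
    IsGermImage φ g (GermArrow.of f' hf' (φ g.src) (h _ hgO).1) := by
  refine ⟨f, hf, g.src, hg.1, f', hf', _, GermArrow.eq_of_of_mem_sheet hf hg, rfl, ?_⟩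
  filter_upwards [hO.mem_nhds hgO] with z hz using (h z hz).2

/-- Near `germ_x f`, the map is `φ ∘ src` followed by the inverse sheet chart of a descent of `f`.
-/
theorem contMDiff_germMap [IsManifold (𝓡 n) ∞ M] [IsManifold (𝓡 m) ∞ N]
    (hφ : IsLocalDiffeomorph (𝓡 n) (𝓡 m) ∞ φ) (hp : ∀ x, q (φ x) = p x) :
    ContMDiff (𝓡 n) (𝓡 m) ∞ (germMap (p := p) (q := q) hφ hp) := by
  intro g
  obtain ⟨f, hf, x, hx, rfl⟩ := g.exists_eq_of
  obtain ⟨f', hf', O, hO, hxO, -, hOf, -⟩ := exists_descent hφ hp hf hx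
  have h1 : ContMDiffAt (𝓡 m) (𝓡 m) ∞ (GermArrow.sheetChart f' hf').symm
      (φ (GermArrow.of f hf x hx).src) :=
    (GermArrow.contMDiffOn_sheetChart_symm f' hf').contMDiffAt
      (f'.open_source.mem_nhds (hOf x hxO).1)
  have h2 : ContMDiffAt (𝓡 n) (𝓡 m) ∞ (φ ∘ (GermArrow.src : GermArrow n p → M))
      (GermArrow.of f hf x hx) := (hφ.contMDiff.comp GermArrow.contMDiff_src) _
  refine (h1.comp (GermArrow.of f hf x hx) h2).congr_of_eventuallyEq ?_
  filter_upwards [(GermArrow.isOpen_sheet hf).mem_nhds (GermArrow.of_mem_sheet f hf x hx),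
    (hO.preimage GermArrow.continuous_src).mem_nhds hxO] with k hk hkO
  rw [germMap_eq_of hφ hp (isGermImage_of_descent hf hf' hO hOf hk hkO)]
  exact (GermArrow.sheetChart_symm_apply _ _ (hOf _ hkO).1).symm

/-- The image of each arrow `germ_x f` has a neighborhood whose preimage lies in the sheet of `f`:
if `germMap` sends `g` into the sheet of a descent of `f`, then `φ ∘ g = φ ∘ f` near the source of
`g`, and `φ` can be cancelled where it is injective. The target component is what confines `g` to
such a region. On a sheet the source determines the arrow continuously, whence injectivity and the
inducing property. -/
theorem isEmbedding_src_tgt_germMap [IsManifold (𝓡 n) ∞ M] [IsManifold (𝓡 m) ∞ N]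
    (hφ : IsLocalDiffeomorph (𝓡 n) (𝓡 m) ∞ φ) (hp : ∀ x, q (φ x) = p x) :
    IsEmbedding (fun g : GermArrow n p => (g.src, g.tgt, germMap (q := q) hφ hp g)) := by
  have hcont : Continuous (fun g : GermArrow n p => (g.src, g.tgt, germMap (q := q) hφ hp g)) :=
    GermArrow.continuous_src.prodMk (GermArrow.contMDiff_tgt.continuous.prodMk
      (contMDiff_germMap hφ hp).continuous)
  have key : ∀ (f : Transition n M) (hf : f ∈ liftPseudogroup n p) (x : M) (hx : x ∈ f.source),
      ∃ W : Set (M × M × GermArrow m q), IsOpen W ∧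
        ((x, f x, germMap hφ hp (GermArrow.of f hf x hx)) : M × M × GermArrow m q) ∈ W ∧
        ∀ g : GermArrow n p, (g.src, g.tgt, germMap (q := q) hφ hp g) ∈ W →
          g ∈ GermArrow.sheet f := by
    intro f hf x hx
    obtain ⟨f', hf', O, hO, hxO, hOs, hOf, O', hO', hinj, hOO'⟩ := exists_descent hφ hp hf hx
    refine ⟨O ×ˢ (O' ×ˢ GermArrow.sheet f'), hO.prod (hO'.prod (GermArrow.isOpen_sheet hf')),
      ⟨hxO, hOO' x hxO, ?_⟩, ?_⟩
    · have h := germMap_eq_of hφ hp (isGermImage_of_descent hf hf' hO hOf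
        (GermArrow.of_mem_sheet f hf x hx) hxO)
      simp only
      rw [h]
      exact GermArrow.of_mem_sheet _ _ _ _
    · rintro g ⟨hg1, hg2, hg3⟩
      simp only at hg1 hg2 hg3
      have h1 := isGermImage_germMap (q := q) hφ hp g
      rw [GermArrow.eq_of_of_mem_sheet hf' hg3] at h1
      obtain ⟨f₁, hf₁, z, hz, rfl⟩ := g.exists_eq_of
      have h2 := h1.eventuallyEq hφ.contMDiff.continuous.continuousAt
      refine ⟨hOs hg1, Germ.coe_eq.2 ?_⟩
      filter_upwards [h2, hO.mem_nhds hg1,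
        (Transition.continuousAt f₁ hz).eventually (hO'.mem_nhds hg2)] with w hw hwO hw'
      refine hinj hw' (hOO' w hwO) ?_
      exact hw.symm.trans (hOf w hwO).2
  refine ⟨isInducing_iff_nhds.2 fun g => le_antisymm (hcont.tendsto g).le_comap ?_, ?_⟩
  · obtain ⟨f, hf, x, hx, rfl⟩ := g.exists_eq_of
    obtain ⟨W, hW, hxW, hWs⟩ := key f hf x hx
    intro U hU
    have hxs := GermArrow.of_mem_sheet f hf x hx
    have hs : (GermArrow.sheetChart f hf).symm x = GermArrow.of f hf x hx :=
      GermArrow.sheetChart_symm_apply f hf hx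
    have hc := (GermArrow.sheetChart f hf).continuousAt_symm (x := x) hx
    rw [ContinuousAt, hs] at hc
    have hV := hc hU
    -- `W` forces `g` into the sheet of `f`, where `g` is recovered from its source; the second set
    -- then places it in `U`.
    refine ⟨W ∩ (Prod.fst ⁻¹' ((GermArrow.sheetChart f hf).symm ⁻¹' U)),
      inter_mem (hW.mem_nhds hxW) (continuous_fst.continuousAt hV), ?_⟩
    rintro g ⟨hg1, hg2⟩
    have h1 := (GermArrow.sheetChart f hf).left_inv (hWs g hg1)
    change (GermArrow.sheetChart f hf).symm g.src ∈ U at hg2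
    change (GermArrow.sheetChart f hf).symm g.src = g at h1
    rwa [h1] at hg2
  · intro g g' h
    obtain ⟨f, hf, x, hx, rfl⟩ := g'.exists_eq_of
    obtain ⟨W, hW, hxW, hWs⟩ := key f hf x hx
    have h1 := hWs g (by
      simp only at h
      rw [h]
      exact hxW)
    rw [GermArrow.eq_of_of_mem_sheet hf h1]
    exact GermArrow.of_eq_of (congrArg Prod.fst h) EventuallyEq.rfl

end GermLifts

/-! ### Weak equivalences of germ groupoids versus local diffeomorphisms over `Q`. -/

section GermGroupoids

variable {n m : ℕ} {M : Type v} {N : Type w} {Q : Type u} [TopologicalSpace M]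
  [TopologicalSpace N] [ChartedSpace (EuclideanSpace ℝ (Fin n)) M]
  [ChartedSpace (EuclideanSpace ℝ (Fin m)) N] [IsManifold (𝓡 n) ∞ M] [IsManifold (𝓡 m) ∞ N]
  {p : M → Q} {q : N → Q} {φ : M → N}

/-- The first component, the source map, is already a local diffeomorphism. -/
theorem injective_mfderiv_src_tgt_germMap (hφ : IsLocalDiffeomorph (𝓡 n) (𝓡 m) ∞ φ)
    (hp : ∀ x, q (φ x) = p x) (g : GermArrow n p) :
    Function.Injective (mfderiv (𝓡 n) ((𝓡 n).prod ((𝓡 n).prod (𝓡 m)))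
      (fun g : GermArrow n p => (g.src, g.tgt, germMap (q := q) hφ hp g)) g) := by
  let F : GermArrow n p → M × M × GermArrow m q :=
    fun g => (g.src, g.tgt, germMap (q := q) hφ hp g)
  have hF : ContMDiff (𝓡 n) ((𝓡 n).prod ((𝓡 n).prod (𝓡 m))) ∞ F :=
    GermArrow.contMDiff_src.prodMk (GermArrow.contMDiff_tgt.prodMk (contMDiff_germMap hφ hp))
  have h1 : mfderiv (𝓡 n) (𝓡 n) (Prod.fst ∘ F) g =
      (mfderiv ((𝓡 n).prod ((𝓡 n).prod (𝓡 m))) (𝓡 n) Prod.fst (F g)).comp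
        (mfderiv (𝓡 n) ((𝓡 n).prod ((𝓡 n).prod (𝓡 m))) F g) :=
    mfderiv_comp g mdifferentiableAt_fst ((hF g).mdifferentiableAt (by simp))
  have h2 : Function.Injective (mfderiv (𝓡 n) (𝓡 n) (Prod.fst ∘ F) g) :=
    (bijective_mfderiv (pullbackCharts_isLocalDiffeomorph
      (GermArrow.isLocalHomeomorph_src (n := n) (p := p)) g)).1
  rw [h1] at h2
  exact Function.Injective.of_comp h2

variable [T2Space M] [T2Space N]

/-- The homomorphism of germ groupoids induced by a local diffeomorphism over `Q`. -/
def germHom (hφ : IsLocalDiffeomorph (𝓡 n) (𝓡 m) ∞ φ) (hp : ∀ x, q (φ x) = p x) :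
    LieGroupoid.Hom (germGroupoid n p) (germGroupoid m q) where
  obj := φ
  arr := germMap hφ hp
  contMDiff_obj := hφ.contMDiff
  contMDiff_arr := contMDiff_germMap hφ hp
  src_arr g := (isGermImage_germMap hφ hp g).src_eq
  tgt_arr g := (isGermImage_germMap hφ hp g).tgt_eq
  arr_comp g f h := germMap_eq_of hφ hp
    ((isGermImage_germMap hφ hp f).comp (isGermImage_germMap hφ hp g) h
      (((isGermImage_germMap hφ hp g).src_eq.trans (congrArg φ h)).trans
        (isGermImage_germMap hφ hp f).tgt_eq.symm))
  arr_unit x := germMap_eq_of hφ hp (IsGermImage.unit (M := M) (N := N) x)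
  arr_inv g := germMap_eq_of hφ hp ((isGermImage_germMap hφ hp g).inv hφ.contMDiff.continuous)

/-- Since `φ` and the structure maps are étale, the submersion condition is automatic. The fibered
product condition is the lifting of arrows together with the embedding above, so only essential
surjectivity is assumed. -/
theorem germHom_isWeakEquivalence (hφ : IsLocalDiffeomorph (𝓡 n) (𝓡 m) ∞ φ)
    (hp : ∀ x, q (φ x) = p x)
    (hsurj : ∀ y : N, ∃ (k : GermArrow m q) (x : M), k.src = φ x ∧ k.tgt = y) :
    (germHom hφ hp).IsWeakEquivalence where
  surjective := hsurj
  submersion h x hx a := by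
    obtain ⟨b, hb⟩ := GermArrow.submersion_tgt (n := m) (p := q) h a
    have hs : Function.Surjective (mfderiv (𝓡 n) (𝓡 m) φ x) := (bijective_mfderiv (hφ x)).2
    obtain ⟨c, hc⟩ := hs (mfderiv (𝓡 m) (𝓡 m) (GermArrow.src : GermArrow m q → N) h b)
    exact ⟨b, c, hc.symm, hb⟩
  range_eq := by
    ext ⟨x, y, k⟩
    constructor
    · rintro ⟨g, hg⟩
      have h := isGermImage_germMap (q := q) hφ hp g
      obtain rfl : g.src = x := congrArg Prod.fst hg
      obtain rfl : g.tgt = y := congrArg (fun r => r.2.1) hg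
      obtain rfl : germMap hφ hp g = k := congrArg (fun r => r.2.2) hg
      exact ⟨h.src_eq.symm, h.tgt_eq.symm⟩
    · rintro ⟨hx, hy⟩
      obtain ⟨g, rfl, rfl, hg⟩ := exists_isGermImage_of_src_of_tgt hφ hp k hx hy
      exact ⟨g, congrArg (fun r => (g.src, g.tgt, r)) (germMap_eq_of hφ hp hg)⟩
  isEmbedding := isEmbedding_src_tgt_germMap hφ hp
  immersion g := by
    exact injective_mfderiv_src_tgt_germMap hφ hp g

/-- The base map of a weak equivalence of germ groupoids is a local diffeomorphism. -/
theorem isLocalDiffeomorph_obj_of_isWeakEquivalence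
    {φ : LieGroupoid.Hom (germGroupoid n p) (germGroupoid m q)} (h : φ.IsWeakEquivalence) :
    IsLocalDiffeomorph (M := M) (N := N) (𝓡 n) (𝓡 m) ∞ φ.obj := by
  intro x
  let φ₀ : M → N := φ.obj
  have hφ₀ : ContMDiff (𝓡 n) (𝓡 m) ∞ φ₀ := φ.contMDiff_obj
  refine isLocalDiffeomorphAt_of_isolated (f := φ₀) hφ₀ ?_ ?_
  -- Surjectivity of the derivative: at the unit `u`, the derivative of the target is surjective
  -- between spaces of equal dimension, hence injective. The submersion condition applied to the
  -- image of `b` therefore returns `b` itself, whose source derivative is `a`.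
  · let u : GermArrow m q := GermArrow.unit m q (φ₀ x)
    have htgt : Function.Injective (mfderiv (𝓡 m) (𝓡 m) (GermArrow.tgt : GermArrow m q → N) u) :=
      (LinearMap.injective_iff_surjective (V := EuclideanSpace ℝ (Fin m))
        (f := (show EuclideanSpace ℝ (Fin m) →L[ℝ] EuclideanSpace ℝ (Fin m) from
          mfderiv (𝓡 m) (𝓡 m) (GermArrow.tgt : GermArrow m q → N) u).toLinearMap)).2
        (GermArrow.submersion_tgt u)
    intro a
    obtain ⟨b, hb⟩ := GermArrow.submersion_src u a
    obtain ⟨b', c, hc, hb'⟩ := h.submersion u x rfl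
      (mfderiv (𝓡 m) (𝓡 m) (GermArrow.tgt : GermArrow m q → N) u b)
    obtain rfl : b' = b := htgt hb'
    exact ⟨c, hc.symm.trans hb⟩
  -- Isolation in the fiber: if `φ₀ y = φ₀ x`, the triple of `y`, `x` and the unit at `φ₀ x` is `F
  -- g` for an arrow `g` from `y` to `x`. For `y` near `x` the embedding forces `g` into the sheet
  -- of the identity, so `y = x`.
  · let F : GermArrow n p → M × M × GermArrow m q := fun g => (g.src, g.tgt, φ.arr g)
    have hF : IsEmbedding F := h.isEmbedding
    have hFu : F (GermArrow.unit n p x) = (x, x, GermArrow.unit m q (φ₀ x)) :=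
      congrArg (fun r => (x, x, r)) (φ.arr_unit x)
    have hs : GermArrow.sheet (Transition.refl n M) ∈ 𝓝 (GermArrow.unit n p x) :=
      (GermArrow.isOpen_sheet GermArrow.refl_mem).mem_nhds (GermArrow.of_mem_sheet _ _ _ _)
    rw [hF.nhds_eq_comap, hFu] at hs
    obtain ⟨W, hW, hWs⟩ := hs
    have hc : Continuous fun y : M => (y, x, GermArrow.unit m q (φ₀ x)) := by fun_prop
    filter_upwards [hc.continuousAt hW] with y hy hyx
    have hr : (y, x, GermArrow.unit m q (φ₀ x)) ∈ range F :=
      h.range_eq ▸ (⟨hyx, rfl⟩ : φ₀ y = φ₀ x ∧ φ₀ x = φ₀ x)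
    obtain ⟨g, hg⟩ := hr
    have hgs : g ∈ GermArrow.sheet (Transition.refl n M) := hWs (by
      change F g ∈ W
      rw [hg]
      exact hy)
    have h1 : g.src = y := congrArg Prod.fst hg
    have h2 : g.tgt = x := congrArg (fun r => r.2.1) hg
    have h3 : g.tgt = g.src := GermArrow.tgt_eq_on_sheet GermArrow.refl_mem hgs
    rw [← h1, ← h3, h2]

end GermGroupoids

/-! ### Transport of partial diffeomorphisms along local diffeomorphisms. -/

section Transport

variable {n m k l : ℕ} {M N A B : Type*} [TopologicalSpace M] [TopologicalSpace N]
  [TopologicalSpace A] [TopologicalSpace B]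
  [ChartedSpace (EuclideanSpace ℝ (Fin n)) M] [ChartedSpace (EuclideanSpace ℝ (Fin m)) N]
  [ChartedSpace (EuclideanSpace ℝ (Fin k)) A] [ChartedSpace (EuclideanSpace ℝ (Fin l)) B]

theorem isLocalDiffeomorphAt_of_comp {f : M → N} {g : N → A} {x : M}
    (hf : IsLocalDiffeomorphAt (𝓡 n) (𝓡 m) ∞ f x)
    (hg : IsLocalDiffeomorphAt (𝓡 n) (𝓡 k) ∞ (g ∘ f) x) :
    IsLocalDiffeomorphAt (𝓡 m) (𝓡 k) ∞ g (f x) := by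
  have h1 : hf.localInverse (f x) = x := hf.localInverse_left_inv hf.localInverse_mem_target
  have h2 : IsLocalDiffeomorphAt (𝓡 n) (𝓡 k) ∞ (g ∘ f) (hf.localInverse (f x)) := by rwa [h1]
  refine isLocalDiffeomorphAt_congr (hf.localInverse_isLocalDiffeomorphAt.comp (𝓡 k) A h2) ?_
  filter_upwards [hf.localInverse_eventuallyEq_right] with z hz
  exact (congrArg g hz).symm

/-- Partial diffeomorphisms can be pulled back along local diffeomorphisms. -/
theorem exists_pullback_partialDiffeomorph {a : M → A} {b : N → B} {x : M} {y : N}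
    (ha : IsLocalDiffeomorphAt (𝓡 n) (𝓡 k) ∞ a x) (hb : IsLocalDiffeomorphAt (𝓡 m) (𝓡 l) ∞ b y)
    (h : PartialDiffeomorph (𝓡 k) (𝓡 l) A B ∞) (hx : a x ∈ h.source) (hxy : h (a x) = b y) :
    ∃ h' : PartialDiffeomorph (𝓡 n) (𝓡 m) M N ∞, x ∈ h'.source ∧ h' x = y ∧
      ∀ z ∈ h'.source, a z ∈ h.source ∧ b (h' z) = h (a z) := by
  obtain ⟨e, hxe, he⟩ := ha
  obtain ⟨d, hyd, hd⟩ := hb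
  have hye : h (e x) = d y := by rw [← he hxe, hxy, hd hyd]
  refine ⟨e.trans (h.trans d.symm), ⟨hxe, ?_, ?_⟩, ?_, ?_⟩
  · change e x ∈ h.source
    rwa [← he hxe]
  · change h (e x) ∈ d.target
    rw [hye]
    exact d.map_source hyd
  · change d.symm (h (e x)) = y
    rw [hye]
    exact d.left_inv hyd
  · rintro z ⟨hz1, hz2, hz3⟩
    change e z ∈ h.source at hz2
    change h (e z) ∈ d.target at hz3
    rw [he hz1]
    exact ⟨hz2, (hd (d.map_target hz3)).trans (d.right_inv hz3)⟩

/-- Partial diffeomorphisms can be pushed forward along local diffeomorphisms. -/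
theorem exists_pushforward_partialDiffeomorph {a : M → A} {b : N → B} {x : M}
    (h : PartialDiffeomorph (𝓡 n) (𝓡 m) M N ∞) (hx : x ∈ h.source)
    (ha : IsLocalDiffeomorphAt (𝓡 n) (𝓡 k) ∞ a x)
    (hb : IsLocalDiffeomorphAt (𝓡 m) (𝓡 l) ∞ b (h x)) :
    ∃ h' : PartialDiffeomorph (𝓡 k) (𝓡 l) A B ∞, a x ∈ h'.source ∧ h' (a x) = b (h x) ∧
      ∀ w ∈ h'.source, ∃ z ∈ h.source, a z = w ∧ h' w = b (h z) := by
  obtain ⟨e, hxe, he⟩ := ha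
  obtain ⟨d, hyd, hd⟩ := hb
  have hex : e.symm (a x) = x := by rw [he hxe]; exact e.left_inv hxe
  refine ⟨e.symm.trans (h.trans d), ⟨?_, ?_⟩, ?_, ?_⟩
  · change a x ∈ e.target
    rw [he hxe]
    exact e.map_source hxe
  · change e.symm (a x) ∈ (h.trans d).source
    rw [hex]
    exact ⟨hx, hyd⟩
  · change d (h (e.symm (a x))) = _
    rw [hex, hd hyd]
  · rintro w ⟨hw1, hw2, hw3⟩
    exact ⟨e.symm w, hw2, (he (e.map_target hw1)).trans (e.right_inv hw1), (hd hw3).symm⟩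

end Transport

variable {Q : Type u} [TopologicalSpace Q] {n m k : ℕ}

/-! ### Small charts inside an orbifold chart. -/

namespace OrbifoldChart

theorem proj_eq_iff (c : OrbifoldChart Q n) {x y : c.V} :
    c.proj x = c.proj y ↔ ∃ g ∈ c.G, g x = y := by
  obtain ⟨e, he⟩ := c.quotient_homeo
  rw [← he, ← he, SetCoe.ext_iff, e.injective.eq_iff]
  exact Quotient.eq (r := orbitRelation c.G)

/-- A continuous open map whose fibers are the orbits of `G` induces a homeomorphism from the
orbit space onto its image. -/
theorem exists_quotient_homeomorph {V : Type u} [TopologicalSpace V] (G : Subgroup (V ≃ₜ V))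
    {f : V → Q} (hc : Continuous f) (ho : IsOpenMap f)
    (hf : ∀ x y, f x = f y ↔ ∃ g ∈ G, g x = y) :
    ∃ e : Quotient (orbitRelation G) ≃ₜ range f,
      ∀ x : V, (e (Quotient.mk (orbitRelation G) x) : Q) = f x := by
  let F : Quotient (orbitRelation G) → range f :=
    Quotient.lift (s := orbitRelation G) (rangeFactorization f) fun x y h =>
      Subtype.ext ((hf x y).2 h)
  have hF : Function.Bijective F := by
    refine ⟨?_, ?_⟩
    · rintro ⟨x⟩ ⟨y⟩ h
      exact Quotient.sound (s := orbitRelation G) ((hf x y).1 (congrArg Subtype.val h))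
    · rintro ⟨_, x, rfl⟩
      exact ⟨Quotient.mk _ x, rfl⟩
  refine ⟨Equiv.toHomeomorphOfContinuousOpen (Equiv.ofBijective F hF)
    (hc.rangeFactorization.quotient_lift _) ?_, fun x => rfl⟩
  intro O hO
  have h1 : IsOpen (f '' (Quotient.mk (orbitRelation G) ⁻¹' O)) :=
    ho _ (hO.preimage continuous_quot_mk)
  convert h1.preimage (continuous_subtype_val (p := (· ∈ range f))) using 1
  ext ⟨y, hy⟩
  constructor
  · rintro ⟨⟨x⟩, hx, h⟩
    exact ⟨x, hx, congrArg Subtype.val h⟩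
  · rintro ⟨x, hx, h⟩
    exact ⟨Quotient.mk _ x, hx, Subtype.ext h⟩

/-- The stabilizer of a point of a chart has arbitrarily small connected open neighborhoods which
meet none of their translates by the other elements of the group. -/
theorem exists_slice (c : OrbifoldChart Q n) (x : c.V) {O : Set c.V} (hO : O ∈ 𝓝 x) :
    ∃ U : Set c.V, IsOpen U ∧ IsConnected U ∧ x ∈ U ∧ U ⊆ O ∧
      ∀ g ∈ c.G, ∀ z ∈ U, g z ∈ U → ∀ w, w ∈ U ↔ g w ∈ U := by
  have := c.finite_G
  have hloc : LocallyConnectedSpace c.V :=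
    ChartedSpace.locallyConnectedSpace (EuclideanSpace ℝ (Fin n)) c.V
  obtain ⟨O₀, hO₀O, hO₀, hxO₀⟩ := mem_nhds_iff.1 hO
  -- Each `g` moving `x` gets a neighborhood of `x` disjoint from its translate; finiteness of the
  -- group allows intersecting all of them.
  have hW : ∀ g : c.G, ∃ W : Set c.V, IsOpen W ∧ x ∈ W ∧
      ((g : c.V ≃ₜ c.V) x ≠ x → ∀ z ∈ W, (g : c.V ≃ₜ c.V) z ∉ W) := by
    rintro ⟨g, hg⟩
    by_cases h : g x = x
    · exact ⟨univ, isOpen_univ, mem_univ _, fun h' => absurd h h'⟩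
    · obtain ⟨A, B, hA, hB, hgA, hxB, hAB⟩ := t2_separation h
      exact ⟨B ∩ g ⁻¹' A, hB.inter (hA.preimage g.continuous), ⟨hxB, hgA⟩,
        fun _ z hz hz' => disjoint_left.1 hAB hz.2 hz'.1⟩
  choose W hWo hxW hW using hW
  let O₁ : Set c.V := O₀ ∩ ⋂ g : c.G, W g
  have hO₁ : IsOpen O₁ := hO₀.inter (isOpen_iInter_of_finite hWo)
  have hxO₁ : x ∈ O₁ := ⟨hxO₀, mem_iInter.2 hxW⟩
  -- Intersecting the preimages of `O₁` under the stabilizer of `x` gives a stabilizer-invariant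
  -- set. Its component containing `x` inherits the invariance and is open by local connectedness.
  let O₂ : Set c.V := ⋂ g : {g : c.G // (g : c.V ≃ₜ c.V) x = x}, (g.1 : c.V ≃ₜ c.V) ⁻¹' O₁
  have hO₂ : IsOpen O₂ :=
    isOpen_iInter_of_finite fun g => hO₁.preimage (g.1 : c.V ≃ₜ c.V).continuous
  have hxO₂ : x ∈ O₂ := mem_iInter.2 fun g => by
    change (g.1 : c.V ≃ₜ c.V) x ∈ O₁
    rwa [g.2]
  have hO₂₁ : O₂ ⊆ O₁ := fun z hz => mem_iInter.1 hz ⟨1, rfl⟩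
  have hinv₂ : ∀ g ∈ c.G, g x = x → MapsTo g O₂ O₂ := by
    intro g hg hgx z hz
    refine mem_iInter.2 fun k => ?_
    exact mem_iInter.1 hz ⟨k.1 * (⟨g, hg⟩ : c.G), (congrArg (k.1 : c.V ≃ₜ c.V) hgx).trans k.2⟩
  let U := connectedComponentIn O₂ x
  have hU₂ : U ⊆ O₂ := connectedComponentIn_subset _ _
  have hxU : x ∈ U := mem_connectedComponentIn hxO₂
  have hinv : ∀ g ∈ c.G, g x = x → MapsTo g U U := by
    intro g hg hgx
    refine mapsTo_iff_image_subset.2 ?_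
    refine (isPreconnected_connectedComponentIn.image g
      g.continuous.continuousOn).subset_connectedComponentIn ⟨x, hxU, hgx⟩ ?_
    exact ((hinv₂ g hg hgx).mono_left hU₂).image_subset
  refine ⟨U, hO₂.connectedComponentIn, isConnected_connectedComponentIn_iff.2 hxO₂, hxU,
    fun z hz => hO₀O (hO₂₁ (hU₂ hz)).1, ?_⟩
  intro g hg z hz hgz w
  -- An element that carries some point of `U` into `U` lies in the stabilizer, by the choice of `W
  -- g`.
  have hgx : g x = x := by
    by_contra h
    exact hW ⟨g, hg⟩ h z (mem_iInter.1 (hO₂₁ (hU₂ hz)).2 _) (mem_iInter.1 (hO₂₁ (hU₂ hgz)).2 _)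
  refine ⟨fun hw => hinv g hg hgx hw, fun hw => ?_⟩
  have hgx' : g⁻¹ x = x := by
    conv_lhs => rw [← hgx]
    exact g.symm_apply_apply x
  have h1 := hinv g⁻¹ (c.G.inv_mem hg) hgx' hw
  have h2 : g⁻¹ (g w) = w := g.symm_apply_apply w
  rwa [h2] at h1

/-- The homeomorphisms of `U` induced by elements of `G`. -/
def inducedSubgroup {V : Type u} [TopologicalSpace V] (G : Subgroup (V ≃ₜ V)) (U : Set V) :
    Subgroup (U ≃ₜ U) where
  carrier := {k | ∃ g ∈ G, ∀ z : U, (k z : V) = g z}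
  one_mem' := ⟨1, G.one_mem, fun _ => rfl⟩
  mul_mem' := by
    rintro k l ⟨g, hg, hk⟩ ⟨h, hh, hl⟩
    refine ⟨g * h, G.mul_mem hg hh, fun z => ?_⟩
    exact (hk (l z)).trans (congrArg g (hl z))
  inv_mem' := by
    rintro k ⟨g, hg, hk⟩
    refine ⟨g⁻¹, G.inv_mem hg, fun z => ?_⟩
    have h1 : (z : V) = g (k.symm z) := by
      rw [← hk]
      exact congrArg Subtype.val (k.apply_symm_apply z).symm
    change (k.symm z : V) = g.symm z
    rw [h1, g.symm_apply_apply]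

theorem finite_inducedSubgroup {V : Type u} [TopologicalSpace V] (G : Subgroup (V ≃ₜ V))
    [Finite G] (U : Set V) : Finite (inducedSubgroup G U) := by
  have h : ∀ k : inducedSubgroup G U, ∃ g : G, ∀ z : U, (k.1 z : V) = (g : V ≃ₜ V) z :=
    fun ⟨k, g, hg, h⟩ => ⟨⟨g, hg⟩, h⟩
  choose F hF using h
  refine Finite.of_injective F fun k l hkl => Subtype.ext (Homeomorph.ext fun z => Subtype.ext ?_)
  rw [hF, hF, hkl]

/-- Every point of a chart has arbitrarily small neighborhoods which are again charts. -/
theorem exists_restriction (c : OrbifoldChart Q n) (x : c.V) {O : Set c.V} (hO : O ∈ 𝓝 x) :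
    ∃ (c' : OrbifoldChart Q n) (j : c'.V → c.V), IsLocalDiffeomorph (𝓡 n) (𝓡 n) ∞ j ∧
      (∀ z, c.proj (j z) = c'.proj z) ∧ x ∈ range j ∧ range j ⊆ O := by
  have := c.finite_G
  obtain ⟨U, hU, hUc, hxU, hUO, hUG⟩ := c.exists_slice x hO
  have hval : IsLocalHomeomorph (Subtype.val : U → c.V) :=
    hU.isOpenEmbedding_subtypeVal.isLocalHomeomorph
  let _ : ChartedSpace (EuclideanSpace ℝ (Fin n)) U := pullbackCharts hval
  have hman : IsManifold (𝓡 n) ∞ U := pullbackCharts_isManifold hval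
  have hdiff : IsLocalDiffeomorph (𝓡 n) (𝓡 n) ∞ (Subtype.val : U → c.V) :=
    pullbackCharts_isLocalDiffeomorph hval
  have hconn : ConnectedSpace U := isConnected_iff_connectedSpace.1 hUc
  have hopen : IsOpenMap (c.proj ∘ (Subtype.val : U → c.V)) :=
    c.isOpenMap_proj.comp hU.isOpenMap_subtype_val
  let c' : OrbifoldChart Q n :=
    { V := U
      G := inducedSubgroup c.G U
      finite_G := finite_inducedSubgroup c.G U
      smooth_G := by
        rintro k ⟨g, hg, hk⟩
        refine contMDiff_of_comp_isLocalDiffeomorph k.continuous hdiff ?_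
        rw [show Subtype.val ∘ k = g ∘ (Subtype.val : U → c.V) from funext hk]
        exact (c.smooth_G g hg).comp hdiff.contMDiff
      proj := c.proj ∘ Subtype.val
      isOpen_range_proj := hopen.isOpen_range
      quotient_homeo := exists_quotient_homeomorph _
        (c.continuous_proj.comp continuous_subtype_val) hopen (by
          intro z w
          rw [Function.comp_apply, Function.comp_apply, c.proj_eq_iff]
          constructor
          · rintro ⟨g, hg, hgz⟩
            -- By the slice property, an element carrying one point of `U` into `U` preserves `U`,
            -- so it restricts to a homeomorphism of `U`.
            exact ⟨g.subtype (hUG g hg z z.2 (hgz ▸ w.2)), ⟨g, hg, fun _ => rfl⟩,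
              Subtype.ext hgz⟩
          · rintro ⟨k, ⟨g, hg, hk⟩, rfl⟩
            exact ⟨g, hg, (hk z).symm⟩) }
  exact ⟨c', Subtype.val, hdiff, fun _ => rfl, ⟨⟨x, hxU⟩, rfl⟩, by
    rintro _ ⟨z, rfl⟩
    exact hUO z.2⟩

end OrbifoldChart

/-! ### Related atlases and their common refinement. -/

namespace OrbifoldAtlas

/-- The inclusion of a chart into the disjoint union of all charts. -/
def inclusion (𝒱 : OrbifoldAtlas Q n) (c : 𝒱.charts) (x : c.1.V) : 𝒱.Total := ⟨c, x⟩

theorem isLocalDiffeomorph_inclusion (𝒱 : OrbifoldAtlas Q n) (c : 𝒱.charts) :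
    IsLocalDiffeomorph (𝓡 n) (𝓡 n) ∞ (𝒱.inclusion c) := fun x =>
  ⟨sigmaInclusion (V := fun c : 𝒱.charts => c.1.V) c, mem_univ x, fun _ _ => rfl⟩

theorem isLocalDiffeomorph_of_inclusion (𝒱 : OrbifoldAtlas Q n) {N : Type*} [TopologicalSpace N]
    [ChartedSpace (EuclideanSpace ℝ (Fin m)) N] {φ : 𝒱.Total → N}
    (h : ∀ c, IsLocalDiffeomorph (𝓡 n) (𝓡 m) ∞ (φ ∘ 𝒱.inclusion c)) :
    IsLocalDiffeomorph (𝓡 n) (𝓡 m) ∞ φ := fun ⟨c, x⟩ =>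
  isLocalDiffeomorphAt_of_comp (𝒱.isLocalDiffeomorph_inclusion c x) (h c x)

/-- Two atlases are related if points of their total spaces with the same image in `Q` are always
joined by a local diffeomorphism over `Q`. -/
def Related (𝒱 : OrbifoldAtlas Q n) (𝒲 : OrbifoldAtlas Q m) : Prop :=
  ∀ (x : 𝒱.Total) (y : 𝒲.Total), 𝒱.proj x = 𝒲.proj y →
    ∃ h : PartialDiffeomorph (𝓡 n) (𝓡 m) 𝒱.Total 𝒲.Total ∞,
      x ∈ h.source ∧ h x = y ∧ ∀ z ∈ h.source, 𝒲.proj (h z) = 𝒱.proj z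

theorem related_of_compatible {𝒱 𝒲 : OrbifoldAtlas Q n}
    (h : ∀ c ∈ 𝒱.charts, ∀ d ∈ 𝒲.charts, c.Compatible d) : 𝒱.Related 𝒲 := by
  rintro ⟨c, x⟩ ⟨d, y⟩ hxy
  obtain ⟨f, hx, rfl, hf⟩ := h c.1 c.2 d.1 d.2 x y hxy
  obtain ⟨f', hx', hy', hf'⟩ := exists_pushforward_partialDiffeomorph f hx
    (𝒱.isLocalDiffeomorph_inclusion c x) (𝒲.isLocalDiffeomorph_inclusion d (f x))
  refine ⟨f', hx', hy', fun w hw => ?_⟩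
  obtain ⟨z, hz, rfl, h2⟩ := hf' w hw
  rw [h2]
  exact hf z hz

namespace Related

theorem compatible {𝒱 𝒲 : OrbifoldAtlas Q n} (h : 𝒱.Related 𝒲) {c d : OrbifoldChart Q n}
    (hc : c ∈ 𝒱.charts) (hd : d ∈ 𝒲.charts) : c.Compatible d := by
  intro x y hxy
  obtain ⟨f, hx, hy, hf⟩ := h (𝒱.inclusion ⟨c, hc⟩ x) (𝒲.inclusion ⟨d, hd⟩ y) hxy
  obtain ⟨f', hx', hy', hf'⟩ := exists_pullback_partialDiffeomorph
    (𝒱.isLocalDiffeomorph_inclusion ⟨c, hc⟩ x) (𝒲.isLocalDiffeomorph_inclusion ⟨d, hd⟩ y) f hx hy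
  refine ⟨f', hx', hy', fun z hz => ?_⟩
  obtain ⟨h1, h2⟩ := hf' z hz
  exact (congrArg 𝒲.proj h2).trans (hf _ h1)

theorem refl (𝒱 : OrbifoldAtlas Q n) : 𝒱.Related 𝒱 := related_of_compatible 𝒱.compatible

theorem symm {𝒱 : OrbifoldAtlas Q n} {𝒲 : OrbifoldAtlas Q m} (h : 𝒱.Related 𝒲) :
    𝒲.Related 𝒱 := by
  intro y x hyx
  obtain ⟨f, hx, rfl, hf⟩ := h x y hyx.symm
  refine ⟨f.symm, f.map_source hx, f.left_inv hx, fun z hz => ?_⟩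
  exact (hf _ (f.map_target hz)).symm.trans (congrArg 𝒲.proj (f.right_inv hz))

/-- The middle atlas covers `Q`, so there is a point of it over the given point of `Q`; the
diffeomorphisms into and out of that point compose. -/
theorem trans {𝒱 : OrbifoldAtlas Q n} {𝒲 : OrbifoldAtlas Q m} {𝒳 : OrbifoldAtlas Q k}
    (h : 𝒱.Related 𝒲) (h' : 𝒲.Related 𝒳) : 𝒱.Related 𝒳 := by
  intro x z hxz
  obtain ⟨y, hy⟩ := 𝒲.surjective_proj (𝒱.proj x)
  obtain ⟨f, hx, rfl, hf⟩ := h x y hy.symm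
  obtain ⟨f', hx', rfl, hf'⟩ := h' (f x) z (hy.trans hxz)
  exact ⟨f.trans f', ⟨hx, hx'⟩, rfl, fun w hw => (hf' _ hw.2).trans (hf w hw.1)⟩

/-- Related atlases on a non-empty space have the same dimension. -/
theorem dim_eq [Nonempty Q] {𝒱 : OrbifoldAtlas Q n} {𝒲 : OrbifoldAtlas Q m}
    (h : 𝒱.Related 𝒲) : n = m := by
  -- A point is indispensable: over the empty space atlases of all dimensions are related vacuously.
  -- Over a point, the derivative of a joining diffeomorphism is a linear isomorphism.
  obtain ⟨q⟩ := ‹Nonempty Q›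
  obtain ⟨x, hx⟩ := 𝒱.surjective_proj q
  obtain ⟨y, hy⟩ := 𝒲.surjective_proj q
  obtain ⟨f, hxf, -, -⟩ := h x y (hx.trans hy.symm)
  let L : EuclideanSpace ℝ (Fin n) ≃L[ℝ] EuclideanSpace ℝ (Fin m) :=
    (PartialDiffeomorph.isLocalDiffeomorphAt (𝓡 n) (𝓡 m) ∞ f
      hxf).mfderivToContinuousLinearEquiv (by simp)
  simpa using L.toLinearEquiv.finrank_eq

end Related

/-- A local diffeomorphism over `Q` between the total spaces of two atlases makes them related. -/
theorem related_of_isLocalDiffeomorph {𝒱 : OrbifoldAtlas Q n} {𝒲 : OrbifoldAtlas Q m}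
    {φ : 𝒱.Total → 𝒲.Total} (hφ : IsLocalDiffeomorph (𝓡 n) (𝓡 m) ∞ φ)
    (hp : ∀ x, 𝒲.proj (φ x) = 𝒱.proj x) : 𝒱.Related 𝒲 := by
  intro x y hxy
  -- Inside `𝒲`, `φ x` is joined to `y` by compatibility of charts; precomposing with the branch of
  -- `φ` at `x` joins `x` to `y`.
  obtain ⟨f, hx, hy, hf⟩ := Related.refl 𝒲 (φ x) y ((hp x).trans hxy)
  have hid : IsLocalDiffeomorphAt (𝓡 m) (𝓡 m) ∞ (id : 𝒲.Total → 𝒲.Total) y :=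
    ⟨Transition.refl m 𝒲.Total, mem_univ y, fun _ _ => rfl⟩
  obtain ⟨f', hx', hy', hf'⟩ := exists_pullback_partialDiffeomorph (hφ x) hid f hx hy
  refine ⟨f', hx', hy', fun z hz => ?_⟩
  obtain ⟨h1, h2⟩ := hf' z hz
  exact (congrArg 𝒲.proj h2).trans ((hf _ h1).trans (hp z))

/-- The common refinement of two related atlases: all charts which map to both of them by local
diffeomorphisms over `Q`. -/
def refinement {𝒱 : OrbifoldAtlas Q n} {𝒲 : OrbifoldAtlas Q m} (h : 𝒱.Related 𝒲) :
    OrbifoldAtlas Q n where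
  charts := {c | (∃ a : c.V → 𝒱.Total, IsLocalDiffeomorph (𝓡 n) (𝓡 n) ∞ a ∧
      ∀ z, 𝒱.proj (a z) = c.proj z) ∧
    ∃ b : c.V → 𝒲.Total, IsLocalDiffeomorph (𝓡 n) (𝓡 m) ∞ b ∧ ∀ z, 𝒲.proj (b z) = c.proj z}
  compatible := by
    rintro c ⟨⟨a, ha, hac⟩, -⟩ d ⟨⟨b, hb, hbd⟩, -⟩ x y hxy
    -- Compatibility is inherited from `𝒱` alone, by pulling back a transition of `𝒱` along `a` and
    -- `b`.
    obtain ⟨f, hx, hy, hf⟩ := Related.refl 𝒱 (a x) (b y) ((hac x).trans (hxy.trans (hbd y).symm))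
    obtain ⟨f', hx', hy', hf'⟩ := exists_pullback_partialDiffeomorph (ha x) (hb y) f hx hy
    refine ⟨f', hx', hy', fun z hz => ?_⟩
    obtain ⟨h1, h2⟩ := hf' z hz
    rw [← hbd, h2, hf _ h1, hac]
  covers q := by
    obtain ⟨⟨c, x⟩, rfl⟩ := 𝒱.surjective_proj q
    obtain ⟨y, hy⟩ := 𝒲.surjective_proj (𝒱.proj ⟨c, x⟩)
    obtain ⟨f, hx, -, hf⟩ := h _ y hy.symm
    have hi := 𝒱.isLocalDiffeomorph_inclusion c
    -- Restricting the chart to the domain of the joining diffeomorphism `f` makes `f` itself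
    -- provide the map to `𝒲`.
    obtain ⟨c', j, hj, hjp, ⟨x', hx'⟩, hjO⟩ := c.1.exists_restriction x
      ((f.open_source.preimage hi.contMDiff.continuous).mem_nhds hx)
    have hij := isLocalDiffeomorph_comp hi hj
    refine ⟨c', ⟨⟨_, hij, hjp⟩, f ∘ 𝒱.inclusion c ∘ j, fun z => ?_, fun z => ?_⟩, x', ?_⟩
    · exact (hij z).comp (𝓡 m) 𝒲.Total
        (PartialDiffeomorph.isLocalDiffeomorphAt (𝓡 n) (𝓡 m) ∞ f (hjO ⟨z, rfl⟩))
    · exact (hf _ (hjO ⟨z, rfl⟩)).trans (hjp z)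
    · rw [← hjp, hx']
      rfl

/-- The total space is a disjoint union, so the maps can be chosen independently on the charts. -/
theorem exists_refinement_fst {𝒱 : OrbifoldAtlas Q n} {𝒲 : OrbifoldAtlas Q m}
    (h : 𝒱.Related 𝒲) : ∃ φ : (refinement h).Total → 𝒱.Total,
      IsLocalDiffeomorph (𝓡 n) (𝓡 n) ∞ φ ∧ ∀ x, 𝒱.proj (φ x) = (refinement h).proj x := by
  choose a ha hap using fun c : (refinement h).charts => c.2.1
  exact ⟨fun x => a x.1 x.2, isLocalDiffeomorph_of_inclusion _ ha, fun x => hap x.1 x.2⟩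

theorem exists_refinement_snd {𝒱 : OrbifoldAtlas Q n} {𝒲 : OrbifoldAtlas Q m}
    (h : 𝒱.Related 𝒲) : ∃ φ : (refinement h).Total → 𝒲.Total,
      IsLocalDiffeomorph (𝓡 n) (𝓡 m) ∞ φ ∧ ∀ x, 𝒲.proj (φ x) = (refinement h).proj x := by
  choose a ha hap using fun c : (refinement h).charts => c.2.2
  exact ⟨fun x => a x.1 x.2, isLocalDiffeomorph_of_inclusion _ ha, fun x => hap x.1 x.2⟩

/-! ### Unit Morita equivalence in terms of related atlases. -/

/-- Local diffeomorphisms over `Q` induce unit weak equivalences. -/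
theorem exists_isUnitWeakEquivalence {𝒱 : OrbifoldAtlas Q n} {𝒲 : OrbifoldAtlas Q m}
    {φ : 𝒱.Total → 𝒲.Total} (hφ : IsLocalDiffeomorph (𝓡 n) (𝓡 m) ∞ φ)
    (hp : ∀ x, 𝒲.proj (φ x) = 𝒱.proj x) :
    ∃ Φ : MarkedAtlasGroupoid.Hom 𝒱.markedAtlasGroupoid 𝒲.markedAtlasGroupoid,
      Φ.IsUnitWeakEquivalence := by
  refine ⟨germHom hφ hp, germHom_isWeakEquivalence hφ hp fun y => ?_, fun q => ?_⟩
  · obtain ⟨x, hx⟩ := 𝒱.surjective_proj (𝒲.proj y)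
    obtain ⟨g, hg, hg'⟩ := 𝒲.exists_arrow ((hp x).trans hx)
    exact ⟨g, x, hg, hg'⟩
  · obtain ⟨x, rfl⟩ := 𝒱.surjective_proj q
    have h : 𝒱.marking.symm (𝒱.proj x) = Quotient.mk 𝒱.groupoid.orbitSetoid x :=
      𝒱.marking.symm_apply_eq.2 (𝒱.marking_mk x).symm
    change 𝒲.marking (LieGroupoid.Hom.orbitMap (G := 𝒱.groupoid) (H := 𝒲.groupoid)
      (germHom hφ hp) (𝒱.marking.symm (𝒱.proj x))) = 𝒱.proj x
    rw [h]
    exact hp x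

/-- The base map is a local diffeomorphism, and the unit condition evaluated at the orbit of `x`
says that it lies over `Q`. -/
theorem related_of_isUnitWeakEquivalence {𝒱 : OrbifoldAtlas Q n} {𝒲 : OrbifoldAtlas Q m}
    {Φ : MarkedAtlasGroupoid.Hom 𝒱.markedAtlasGroupoid 𝒲.markedAtlasGroupoid}
    (h : Φ.IsUnitWeakEquivalence) : 𝒱.Related 𝒲 := by
  refine related_of_isLocalDiffeomorph
    (isLocalDiffeomorph_obj_of_isWeakEquivalence (n := n) (m := m) (p := 𝒱.proj) (q := 𝒲.proj)
      h.isWeakEquivalence) fun x => ?_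
  have h1 : 𝒱.marking.symm (𝒱.proj x) = Quotient.mk 𝒱.groupoid.orbitSetoid x :=
    𝒱.marking.symm_apply_eq.2 (𝒱.marking_mk x).symm
  have h2 : 𝒲.marking (LieGroupoid.Hom.orbitMap (G := 𝒱.groupoid) (H := 𝒲.groupoid) Φ
      (𝒱.marking.symm (𝒱.proj x))) = 𝒱.proj x := h.unit (𝒱.proj x)
  rw [h1] at h2
  exact h2

/-- Marked atlas groupoids are unit Morita equivalent if and only if the atlases are related. -/
theorem unitMoritaEquivalent_iff_related {𝒱 : OrbifoldAtlas Q n} {𝒲 : OrbifoldAtlas Q m} :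
    𝒱.markedAtlasGroupoid.UnitMoritaEquivalent 𝒲.markedAtlasGroupoid ↔ 𝒱.Related 𝒲 := by
  constructor
  · rintro ⟨⟨_, k, 𝒦, rfl⟩, φ, ψ, hφ, hψ⟩
    exact (related_of_isUnitWeakEquivalence (𝒱 := 𝒦) hφ).symm.trans
      (related_of_isUnitWeakEquivalence (𝒱 := 𝒦) hψ)
  · intro h
    obtain ⟨φ, hφ, hφp⟩ := exists_refinement_fst h
    obtain ⟨ψ, hψ, hψp⟩ := exists_refinement_snd h
    obtain ⟨Φ, hΦ⟩ := exists_isUnitWeakEquivalence hφ hφp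
    obtain ⟨Ψ, hΨ⟩ := exists_isUnitWeakEquivalence hψ hψp
    exact ⟨_, Φ, Ψ, hΦ, hΨ⟩

end OrbifoldAtlas

/-! ### The equivalence relation and its classes. -/

namespace MarkedAtlasGroupoid

theorem exists_eq_markedAtlasGroupoid (A : MarkedAtlasGroupoid Q) :
    ∃ (n : ℕ) (𝒱 : OrbifoldAtlas Q n), A = 𝒱.markedAtlasGroupoid := by
  obtain ⟨_, n, 𝒱, rfl⟩ := A
  exact ⟨n, 𝒱, rfl⟩

/-- Symmetry is the symmetry of spans. Transitivity comes from related atlases, so spans need not be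
composed by fibered products of groupoids. -/
theorem equivalence_unitMoritaEquivalent :
    Equivalence (MarkedAtlasGroupoid.UnitMoritaEquivalent (Q := Q)) where
  refl A := by
    obtain ⟨n, 𝒱, rfl⟩ := A.exists_eq_markedAtlasGroupoid
    exact OrbifoldAtlas.unitMoritaEquivalent_iff_related.2 (.refl 𝒱)
  symm := fun ⟨K, φ, ψ, hφ, hψ⟩ => ⟨K, ψ, φ, hψ, hφ⟩
  trans {A B C} h h' := by
    obtain ⟨_, 𝒱, rfl⟩ := A.exists_eq_markedAtlasGroupoid
    obtain ⟨_, 𝒲, rfl⟩ := B.exists_eq_markedAtlasGroupoid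
    obtain ⟨_, 𝒳, rfl⟩ := C.exists_eq_markedAtlasGroupoid
    rw [OrbifoldAtlas.unitMoritaEquivalent_iff_related] at h h' ⊢
    exact h.trans h'

end MarkedAtlasGroupoid

namespace OrbifoldStructure

/-- An atlas related to an orbifold structure is contained in it. -/
theorem represents_of_related {𝒰 : OrbifoldStructure Q n} {𝒲 : OrbifoldAtlas Q n}
    (h : 𝒲.Related 𝒰.toOrbifoldAtlas) : 𝒲.Represents 𝒰 := by
  -- The union of the two atlases is an atlas containing `𝒰`, hence no larger than `𝒰` by
  -- maximality.
  let 𝒳 : OrbifoldAtlas Q n :=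
    { charts := 𝒰.charts ∪ 𝒲.charts
      compatible := by
        rintro c (hc | hc) d (hd | hd)
        · exact 𝒰.compatible c hc d hd
        · exact h.symm.compatible hc hd
        · exact h.compatible hc hd
        · exact 𝒲.compatible c hc d hd
      covers := fun q => by
        obtain ⟨c, hc, hq⟩ := 𝒲.covers q
        exact ⟨c, .inr hc, hq⟩ }
  exact subset_union_right.trans (𝒰.maximal 𝒳 subset_union_left)

/-- The second hypothesis is an inclusion of chart sets so that the atlas of `𝒰` itself is allowed
as `𝒲`. -/
theorem related_of_represents {𝒰 : OrbifoldStructure Q n} {𝒱 𝒲 : OrbifoldAtlas Q n}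
    (h : 𝒱.Represents 𝒰) (h' : 𝒲.charts ⊆ 𝒰.charts) : 𝒱.Related 𝒲 :=
  OrbifoldAtlas.related_of_compatible fun c hc d hd => 𝒰.compatible c (h hc) d (h' hd)

theorem setOf_unitMoritaEquivalent_eq [Nonempty Q] (𝒰 : OrbifoldStructure Q n)
    {𝒱 : OrbifoldAtlas Q n} (h : 𝒱.Represents 𝒰) :
    {A : MarkedAtlasGroupoid Q | A.UnitMoritaEquivalent 𝒱.markedAtlasGroupoid} =
      𝒰.markedAtlasGroupoids := by
  ext A
  constructor
  · intro hA
    obtain ⟨m, 𝒲, rfl⟩ := A.exists_eq_markedAtlasGroupoid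
    have hr : 𝒲.Related 𝒱 := OrbifoldAtlas.unitMoritaEquivalent_iff_related.1 hA
    -- An atlas in the class may a priori have another dimension; only after the dimensions are
    -- identified can it be compared with `𝒰`.
    obtain rfl := hr.dim_eq
    exact ⟨𝒲, represents_of_related (hr.trans (related_of_represents h Subset.rfl)), rfl⟩
  · rintro ⟨𝒲, hW, rfl⟩
    exact OrbifoldAtlas.unitMoritaEquivalent_iff_related.2 (related_of_represents hW h)

end OrbifoldStructure

end ReducedOrbifold

end

theorem mainTheorem7 (Q : Type u) [TopologicalSpace Q] [T2Space Q] [SecondCountableTopology Q] :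
    Equivalence (ReducedOrbifold.MarkedAtlasGroupoid.UnitMoritaEquivalent (Q := Q)) ∧
    (Nonempty Q → ∀ (n : ℕ) (𝒰 : ReducedOrbifold.OrbifoldStructure Q n)
      (𝒱 : ReducedOrbifold.OrbifoldAtlas Q n), 𝒱.Represents 𝒰 →
      {A : ReducedOrbifold.MarkedAtlasGroupoid Q | A.UnitMoritaEquivalent 𝒱.markedAtlasGroupoid} =
        𝒰.markedAtlasGroupoids) :=
  ⟨ReducedOrbifold.MarkedAtlasGroupoid.equivalence_unitMoritaEquivalent,
    fun _ _ 𝒰 _ h => 𝒰.setOf_unitMoritaEquivalent_eq h⟩
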